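/- Let $d,T\ge 1$, let $f:\mathbb{R}^d\to\mathbb{R}$ be convex, and let $l:\mathbb{R}^d\to\mathbb{R}$ be continuous. Adam++ has inputs $x_0\in\mathbb{R}^d$, $\eta_0>0$, a numerical stabilizer $\kappa\ge 0$, and $\beta_1,\beta_2,\lambda$ with $0<\beta_1<\sqrt{\beta_2}$, $\beta_2<1$, $0<\lambda<1$. For $t=0,1,\dots,T$ it queries an oracle at $x_t$ and receives a random vector $g_t$ whose conditional mean given the past is a subgradient of $f$ at $x_t$ and which satisfies $\|g_t\|_2\le l(x_t)$ almost surely. With $\beta_{1t}=\beta_1\lambda^{t}$, $m_{-1}=v_{-1}=0$, and squares, roots, maxima and quotients taken entrywise (with $0/0=0$), it sets $$m_t=\beta_{1t}m_{t-1}+(1-\beta_{1t})g_t,\qquad x_{t+1}=x_t-\eta_t\,\frac{m_t}{\kappa+s_t},\qquad \eta_{t+1}=\max\Big(\eta_t,\frac{\|x_{t+1}-x_0\|_2}{\sqrt d}\Big),$$ where either (Case 1) $s_t=\big(\sum_{k\le t}g_k^2\big)^{1/2}$ for all $t$, or (Case 2) $v_t=\beta_2v_{t-1}+(1-\beta_2)g_t^2$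 and $s_t=\sqrt{(t+1)\max_{k\le t}v_k}$ for all $t$. Let $\tau\in\arg\max_{t\le T}\sum_{i<t}\eta_i/\eta_t$, $\bar x_\tau=\sum_{t<\tau}\eta_tx_t\big/\sum_{t<\tau}\eta_t$, and, for $x_*\in\mathbb{R}^d$, $D_\tau=\max_{t\le\tau}\|x_t-x_*\|_\infty$. There is a constant $C$ depending only on $\beta_1,\beta_2,\lambda$ such that, in either case, the following holds. Suppose that $l(x)\le G$ for all $x$, where $G>0$, and that $\|s_\tau\|_2\le G\,T^{1/2-\alpha}$ almost surely for some $\alpha\in[0,1/2)$; suppose also that the stabilizer is small, in the sense that $\kappa\sqrt d\le G\,T^{1/2-\alpha}$. Then for every $x_*\in\mathbb{R}^d$ and every $\delta\in(0,1)$, with probability at least $1-\delta$, $$f(\bar x_\tau)-f(x_*)\;\le\; C\Big(1+\log\frac{\eta_T}{\eta_0}\Big)\log\Big(\frac{60\log(6\tau)}{\delta}\Big)\cdot\frac{\max\{D_\tau,\eta_0\}^2\,G\sqrt d}{\eta_0\,T^{1/2+\alpha}} .$$ Thus, where $\eta_0\le D_\tau$ (for instance if $\eta_0\le\|x_0-x_*\|_\infty$)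 and with $\eta_0$ regarded as a constant, $f(\bar x_\tau)-f(x_*)\le\tilde O\big(D_\tau^2G\sqrt d/T^{1/2+\alpha}\big)$, where $\tilde O$ hides the two logarithmic factors; $\alpha=0$ gives the rate $\tilde O(1/\sqrt T)$. -/

import Mathlib

open MeasureTheory

noncomputable section

namespace AdamPP

/-- Points of `ℝ^d`, with the Euclidean norm. -/
abbrev Vec (d : ℕ) := EuclideanSpace ℝ (Fin d)

/-- The `ℓ_∞` norm `max_i |x_i|` (the norm of `Fin d → ℝ` is the supremum norm). -/
def linf {d : ℕ} (x : Vec d) : ℝ := ‖(WithLp.ofLp x : Fin d → ℝ)‖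

/-- The subdifferential `∂f(x)` of a real-valued function on `ℝ^d`. -/
def subdifferential {d : ℕ} (f : Vec d → ℝ) (x : Vec d) : Set (Vec d) :=
  {v | ∀ y, f x + inner ℝ v (y - x) ≤ f y}

/-- The two variants of the accumulator `s_t`. -/
inductive Variant
  | case1
  | case2

/-- The moment parameters of Adam++: the momentum parameters `β₁`, `β₂` and the decay factor
`lam` of the first one. -/
structure Params where
  β₁ : ℝ
  β₂ : ℝ
  lam : ℝ

section Algorithm

variable {d : ℕ} (P : Params) (c : Variant) (η₀ κ : ℝ) (g : ℕ → Vec d) (x₀ : Vec d)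

/-- `β_{1t} = β₁ λ^t`. -/
def beta1 (t : ℕ) : ℝ := P.β₁ * P.lam ^ t

/-- First moment: `m_t = β_{1t} m_{t-1} + (1 - β_{1t}) g_t`, with `m_{-1} = 0`. -/
def m : ℕ → Vec d
  | 0 => (1 - beta1 P 0) • g 0
  | t + 1 => beta1 P (t + 1) • m t + (1 - beta1 P (t + 1)) • g (t + 1)

/-- Second moment, entrywise: `v_t = β₂ v_{t-1} + (1 - β₂) g_t ^ 2`, with `v_{-1} = 0`. -/
def v (i : Fin d) : ℕ → ℝ
  | 0 => (1 - P.β₂) * (g 0 i) ^ 2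
  | t + 1 => P.β₂ * v i t + (1 - P.β₂) * (g (t + 1) i) ^ 2

/-- The accumulator `s_t`: `(∑_{k ≤ t} g_k ^ 2)^{1/2}` in the first variant and
`((t + 1) max_{k ≤ t} v_k)^{1/2}` in the second one, entrywise. -/
def s (t : ℕ) : Vec d :=
  match c with
  | .case1 => WithLp.toLp 2 fun i => √(∑ k ∈ Finset.range (t + 1), (g k i) ^ 2)
  | .case2 => WithLp.toLp 2 fun i =>
      √((t + 1 : ℝ) * (Finset.range (t + 1)).sup' Finset.nonempty_range_add_one (v P g i))

/-- The pair `(x_t, η_t)` produced by Adam++ with starting point `x₀`, initial value `η₀` and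
numerical stabilizer `κ` when the gradients returned by the oracle are `g 0, g 1, …`: the
entries of `x_{t+1}` are `x_{t,i} - η_t m_{t,i} / (κ + s_{t,i})`, and
`η_{t+1} = max(η_t, ‖x_{t+1} - x₀‖₂ / √d)`. -/
def state : ℕ → Vec d × ℝ
  | 0 => (x₀, η₀)
  | t + 1 =>
    let x' : Vec d := WithLp.toLp 2 fun i =>
      (state t).1 i - (state t).2 * (m P g t i / (κ + s P c g t i))
    (x', max (state t).2 (‖x' - x₀‖ / √(d : ℝ)))

/-- The iterate `x_t`. -/
def x (t : ℕ) : Vec d := (state P c η₀ κ g x₀ t).1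

/-- The step size `η_t`. -/
def η (t : ℕ) : ℝ := (state P c η₀ κ g x₀ t).2

/-- The quantity `∑_{i < t} η_i / η_t`. -/
def ratio (t : ℕ) : ℝ := ∑ i ∈ Finset.range t, η P c η₀ κ g x₀ i / η P c η₀ κ g x₀ t

/-- `τ ∈ argmax_{t ≤ T} ∑_{i < t} η_i / η_t`. -/
def IsArgmax (T τ : ℕ) : Prop :=
  τ ≤ T ∧ ∀ t ≤ T, ratio P c η₀ κ g x₀ t ≤ ratio P c η₀ κ g x₀ τ

/-- The weighted average `∑_{k < t} η_k x_k / ∑_{k < t} η_k`. -/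
def xbar (t : ℕ) : Vec d :=
  (∑ k ∈ Finset.range t, η P c η₀ κ g x₀ k)⁻¹ •
    ∑ k ∈ Finset.range t, η P c η₀ κ g x₀ k • x P c η₀ κ g x₀ k

/-- `D_t = max_{k ≤ t} ‖x_k - x_*‖_∞`. -/
def D (xs : Vec d) (t : ℕ) : ℝ :=
  (Finset.range (t + 1)).sup' Finset.nonempty_range_add_one
    fun k => linf (x P c η₀ κ g x₀ k - xs)

end Algorithm

/-- `θ_{t,δ} = log (60 log (6t) / δ)`. -/
def theta (t : ℕ) (δ : ℝ) : ℝ := Real.log (60 * Real.log (6 * t) / δ)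

/-- The random vectors `g 0, …, g T` are stochastic subgradients of `f` returned by an oracle
that is queried at the random points `x 0, …, x T`, where `ℱ t` is the information available
before the oracle is queried at `x t`: given `ℱ t`, the mean of `g t` is a subgradient of `f`
at `x t`, and the norm of `g t` is almost surely bounded by `l (x t)`. -/
structure IsOracleRun {d : ℕ} {Ω : Type*} [mΩ : MeasurableSpace Ω] (μ : Measure Ω)
    (ℱ : Filtration ℕ mΩ) (f l : Vec d → ℝ) (T : ℕ) (x g : ℕ → Ω → Vec d) : Prop where
  adapted : ∀ t ≤ T, StronglyMeasurable[ℱ (t + 1)] (g t)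
  unbiased : ∀ t ≤ T, ∀ᵐ ω ∂μ, (μ[g t | ℱ t]) ω ∈ subdifferential f (x t ω)
  bounded : ∀ t ≤ T, ∀ᵐ ω ∂μ, ‖g t ω‖ ≤ l (x t ω)

end AdamPP

end

/-! The proof splits into one probabilistic event and a pathwise estimate valid on it. Write `B = G
T^(1/2-α)`. By Jensen and the subgradient inequality (`xbar_sub_le_div`) it suffices to bound `∑ η_t
⟪x_t - x_*, h_t⟫ / ∑ η_t`, with `h_t` the conditional mean of `g_t`. Split `h_t = m_t + (g_t - m_t)
+ (h_t - g_t)`.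

The `m_t` part is an AdaGrad argument (`sum_mul_m_mul_le`): the weight `η_t` cancels the step size,
so the squared distances telescope against the nondecreasing weights `κ + s_t`, leaving terms of
size `√d B (D² + η²)`. The momentum error sums to a constant because `β_{1t}` decays geometrically.
The noise part is, after Abel summation, a martingale with increments bounded by `G`, whose
empirical second moments are controlled by `‖s_τ‖² ≤ B²`; a deviation inequality in empirical
variance (`measure_not_forall_abs_sum_le`) therefore costs only `B log(2/δ)`. It is uniform in time,
so the random, future-dependent index `τ` is harmless.

For the denominator, the choice of `τ` gives `∑_{t<τ} η_t ≥ η_τ T / (6 (1 + log (η_T/η_0)))`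
(`lt_mul_one_add_log`), except for short horizons, where a crude bound suffices. Dividing, `B / T =
G / T^(1/2+α)`. -/

noncomputable section

namespace AdamPP

/-! ### A time-uniform deviation inequality with empirical variance -/

section Concentration

/-- This inequality lets the uncentred square `Y²` serve as compensator: it gives conditional mean
at most `exp E * (1 - E) ≤ 1` to `exp (E - Y - Y²)`, where `E` is the conditional mean of `Y`. -/
theorem exp_neg_sub_sq_le {y : ℝ} (hy : |y| ≤ 1 / 2) : Real.exp (-y - y ^ 2) ≤ 1 - y := by
  obtain ⟨h1, h2⟩ := abs_le.1 hy
  have hkey : 1 ≤ Real.exp (y + y ^ 2) * (1 - y) := by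
    rcases le_total 0 y with h | h
    · have hw : 0 ≤ y + y ^ 2 := by positivity
      have he := Real.quadratic_le_exp_of_nonneg hw
      -- With `w = y + y²`, `(1 - y)(1 + w + w²/2) - 1` is `y²` times this factor. For `y ≤ 0` the
      -- linear bound is enough, since `(1 + y + y²)(1 - y) = 1 - y³`.
      have h3 : 0 ≤ (1 + y) * (1 - y ^ 2) / 2 - y := by nlinarith [mul_nonneg h h]
      nlinarith [mul_le_mul_of_nonneg_right he (by linarith : 0 ≤ 1 - y),
        mul_nonneg (sq_nonneg y) h3]
    · have he := Real.add_one_le_exp (y + y ^ 2)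
      have h3 : 0 ≤ -y * y ^ 2 := mul_nonneg (by linarith) (sq_nonneg y)
      nlinarith [mul_le_mul_of_nonneg_right he (by linarith : 0 ≤ 1 - y)]
  calc Real.exp (-y - y ^ 2) = Real.exp (-y - y ^ 2) * 1 := (mul_one _).symm
    _ ≤ Real.exp (-y - y ^ 2) * (Real.exp (y + y ^ 2) * (1 - y)) := by gcongr
    _ = 1 - y := by
      rw [← mul_assoc, ← Real.exp_add, show -y - y ^ 2 + (y + y ^ 2) = 0 by ring, Real.exp_zero,
        one_mul]

/-- The partial products of `w`, frozen as soon as they reach the level `a`. -/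
def stoppedProd (a : ℝ) (w : ℕ → ℝ) : ℕ → ℝ
  | 0 => 1
  | t + 1 => stoppedProd a w t * if a ≤ stoppedProd a w t then 1 else w t

theorem le_stoppedProd_or (a : ℝ) (w : ℕ → ℝ) (t : ℕ) :
    a ≤ stoppedProd a w t ∨ stoppedProd a w t = ∏ k ∈ Finset.range t, w k ∧
      ∀ r ≤ t, ∏ k ∈ Finset.range r, w k < a := by
  induction t with
  | zero =>
    by_cases h : a ≤ 1
    · exact Or.inl h
    · exact Or.inr ⟨by simp [stoppedProd], fun r hr => by simpa [Nat.le_zero.1 hr] using h⟩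
  | succ t ih =>
    rcases ih with h | ⟨h1, h2⟩
    · left; simp [stoppedProd, h]
    · have h3 : ¬ a ≤ stoppedProd a w t := by rw [h1]; exact not_le.2 (h2 t le_rfl)
      have h4 : stoppedProd a w (t + 1) = ∏ k ∈ Finset.range (t + 1), w k := by
        rw [stoppedProd, if_neg h3, Finset.prod_range_succ, h1]
      by_cases h : a ≤ stoppedProd a w (t + 1)
      · exact Or.inl h
      · refine Or.inr ⟨h4, fun r hr => ?_⟩
        rcases Nat.le_succ_iff.1 hr with hr | rfl
        · exact h2 r hr
        · rw [← h4]; exact not_le.1 h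

/-- Freezing turns a crossing of `a` at any time up to `t` into an event about the value at `t`
alone, so Markov's inequality at the last time yields the maximal inequality. -/
theorem le_stoppedProd {a : ℝ} {w : ℕ → ℝ} {t r : ℕ} (hr : r ≤ t)
    (h : a ≤ ∏ k ∈ Finset.range r, w k) : a ≤ stoppedProd a w t :=
  (le_stoppedProd_or a w t).resolve_right fun h' => (h'.2 r hr).not_ge h

theorem stoppedProd_nonneg {a : ℝ} {w : ℕ → ℝ} (hw : ∀ t, 0 ≤ w t) (t : ℕ) :
    0 ≤ stoppedProd a w t := by
  induction t with
  | zero => exact zero_le_one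
  | succ t ih => rw [stoppedProd]; split_ifs <;> simp [ih, mul_nonneg, hw t]

theorem stoppedProd_le {a K : ℝ} {w : ℕ → ℝ} (hw : ∀ t, 0 ≤ w t) (hK : 1 ≤ K) {t : ℕ}
    (h : ∀ k < t, w k ≤ K) : stoppedProd a w t ≤ K ^ t := by
  induction t with
  | zero => simp [stoppedProd]
  | succ t ih =>
    rw [stoppedProd, pow_succ]
    refine mul_le_mul (ih fun k hk => h k (by omega)) ?_ ?_ (by positivity)
    · split_ifs; exacts [hK, h t t.lt_succ_self]
    · split_ifs; exacts [zero_le_one, hw t]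

variable {Ω : Type*} [mΩ : MeasurableSpace Ω] {μ : Measure Ω} [IsProbabilityMeasure μ]
  {ℱ : Filtration ℕ mΩ}

theorem measurable_stoppedProd {a : ℝ} {W : ℕ → Ω → ℝ} {t : ℕ}
    (hW : ∀ k < t, Measurable (W k)) : Measurable fun ω => stoppedProd a (W · ω) t := by
  induction t with
  | zero => exact measurable_const
  | succ t ih =>
    have h := ih fun k hk => hW k (by omega)
    exact h.mul (Measurable.ite (measurableSet_le measurable_const h) measurable_const
      (hW t t.lt_succ_self))

/-- The frozen product is a supermartingale started at 1: on the frozen set it does not move, and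
off it the new factor has conditional mean at most 1. -/
theorem integral_stoppedProd_le_one {a : ℝ} {N : ℕ} {Y : ℕ → Ω → ℝ}
    (hY : ∀ t < N, StronglyMeasurable[ℱ (t + 1)] (Y t)) (hb : ∀ t < N, ∀ᵐ ω ∂μ, |Y t ω| ≤ 1 / 2) :
    Integrable (fun ω => stoppedProd a
        (fun k => Real.exp ((μ[Y k | ℱ k]) ω - Y k ω - Y k ω ^ 2)) N) μ ∧
      ∫ ω, stoppedProd a (fun k => Real.exp ((μ[Y k | ℱ k]) ω - Y k ω - Y k ω ^ 2)) N ∂μ ≤ 1 := by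
  set E : ℕ → Ω → ℝ := fun k => μ[Y k | ℱ k] with hE
  set Z : ℕ → Ω → ℝ := fun t ω =>
    stoppedProd a (fun k => Real.exp (E k ω - Y k ω - Y k ω ^ 2)) t with hZ
  have hEm : ∀ t, Measurable[ℱ t] (E t) := fun t => stronglyMeasurable_condExp.measurable
  have hEb : ∀ t < N, ∀ᵐ ω ∂μ, |E t ω| ≤ 1 / 2 := fun t ht =>
    ae_bdd_abs_condExp_of_ae_bdd_abs (hb t ht)
  have hZm : ∀ t ≤ N, Measurable[ℱ t] (Z t) := fun t ht => by
    refine @measurable_stoppedProd Ω (ℱ t) a _ t fun k hk => ?_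
    have h1 : Measurable[ℱ t] (E k) := (hEm k).mono (ℱ.mono hk.le) le_rfl
    have h2 : Measurable[ℱ t] (Y k) := (hY k (by omega)).measurable.mono (ℱ.mono hk) le_rfl
    exact Real.measurable_exp.comp ((h1.sub h2).sub (h2.pow_const 2))
  have hZ0 : ∀ t ω, 0 ≤ Z t ω := fun t ω => stoppedProd_nonneg (fun _ => (Real.exp_pos _).le) t
  have hZb : ∀ t ≤ N, ∀ᵐ ω ∂μ, ‖Z t ω‖ ≤ Real.exp 1 ^ t := fun t ht => by
    have h1 : ∀ᵐ ω ∂μ, ∀ k < N, |Y k ω| ≤ 1 / 2 ∧ |E k ω| ≤ 1 / 2 := by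
      refine ae_all_iff.2 fun k => ?_
      by_cases hk : k < N
      · filter_upwards [hb k hk, hEb k hk] with ω h h' _ using ⟨h, h'⟩
      · exact Filter.Eventually.of_forall fun ω h => absurd h hk
    filter_upwards [h1] with ω hω
    rw [Real.norm_of_nonneg (hZ0 t ω)]
    refine stoppedProd_le (fun _ => (Real.exp_pos _).le) (Real.one_le_exp zero_le_one)
      fun k hk => Real.exp_le_exp.2 ?_
    obtain ⟨h2, h3⟩ := hω k (by omega)
    nlinarith [abs_le.1 h2, abs_le.1 h3, sq_nonneg (Y k ω)]
  have hZi : ∀ t ≤ N, Integrable (Z t) μ := fun t ht =>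
    Integrable.of_bound ((hZm t ht).mono (ℱ.le t) le_rfl).aestronglyMeasurable _ (hZb t ht)
  refine ⟨hZi N le_rfl, ?_⟩
  have hstep : ∀ t < N, ∫ ω, Z (t + 1) ω ∂μ ≤ ∫ ω, Z t ω ∂μ := fun t ht => by
    set A : Set Ω := {ω | a ≤ Z t ω}
    have hAm : MeasurableSet[ℱ t] A :=
      measurableSet_le measurable_const (hZm t ht.le)
    -- the predictable factor
    set H : Ω → ℝ := Aᶜ.indicator fun ω => Z t ω * Real.exp (E t ω) with hH
    have hHm : Measurable[ℱ t] H :=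
      ((hZm t ht.le).mul (Real.measurable_exp.comp (hEm t))).indicator hAm.compl
    have hHb : ∀ᵐ ω ∂μ, ‖H ω‖ ≤ Real.exp 1 ^ t * Real.exp 1 := by
      filter_upwards [hZb t ht.le, hEb t ht] with ω h1 h2
      refine (norm_indicator_le_norm_self _ _).trans ?_
      rw [norm_mul]
      refine mul_le_mul h1 ?_ (norm_nonneg _) (by positivity)
      rw [Real.norm_of_nonneg (Real.exp_pos _).le]
      exact Real.exp_le_exp.2 (by linarith [abs_le.1 h2])
    have hHs : AEStronglyMeasurable H μ := (hHm.mono (ℱ.le t) le_rfl).aestronglyMeasurable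
    have hHi : Integrable H μ := Integrable.of_bound hHs _ hHb
    have hYi : Integrable (Y t) μ :=
      Integrable.of_bound ((hY t ht).mono (ℱ.le _)).aestronglyMeasurable _ (hb t ht)
    have hHY : Integrable (fun ω => H ω * Y t ω) μ := hYi.bdd_mul hHs hHb
    have hHE : Integrable (fun ω => H ω * E t ω) μ := integrable_condExp.bdd_mul hHs hHb
    have hZA : Integrable (A.indicator (Z t)) μ := (hZi t ht.le).indicator (ℱ.le t _ hAm)
    have hpull : ∫ ω, H ω * Y t ω ∂μ = ∫ ω, H ω * E t ω ∂μ := by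
      have h1 := condExp_mul_of_stronglyMeasurable_left (m := ℱ t) (μ := μ)
        hHm.stronglyMeasurable hHY hYi
      rw [← integral_condExp (ℱ.le t)]
      exact integral_congr_ae h1
    calc ∫ ω, Z (t + 1) ω ∂μ ≤ ∫ ω, (A.indicator (Z t) ω + (H ω - H ω * Y t ω)) ∂μ := by
          refine integral_mono_ae (hZi (t + 1) ht) (hZA.add (hHi.sub hHY)) ?_
          filter_upwards [hb t ht] with ω hω
          have hs : Z (t + 1) ω = Z t ω * if a ≤ Z t ω then 1 else
            Real.exp (E t ω - Y t ω - Y t ω ^ 2) := rfl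
          by_cases h : ω ∈ A
          · have h' : a ≤ Z t ω := h
            simp [hs, h', h, hH]
          · have h' : ¬ a ≤ Z t ω := h
            simp only [hs, if_neg h', hH, Set.indicator_of_notMem h, zero_add,
              Set.indicator_of_mem (Set.mem_compl h)]
            rw [show E t ω - Y t ω - Y t ω ^ 2 = E t ω + (-Y t ω - Y t ω ^ 2) by ring,
              Real.exp_add]
            have := mul_le_mul_of_nonneg_left (exp_neg_sub_sq_le hω)
              (mul_nonneg (hZ0 t ω) (Real.exp_pos (E t ω)).le)
            linarith
      _ = ∫ ω, (A.indicator (Z t) ω + (H ω - H ω * E t ω)) ∂μ := by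
          have e1 : Integrable (fun ω => H ω - H ω * Y t ω) μ := hHi.sub hHY
          have e2 : Integrable (fun ω => H ω - H ω * E t ω) μ := hHi.sub hHE
          rw [integral_add hZA e1, integral_add hZA e2, integral_sub hHi hHY,
            integral_sub hHi hHE, hpull]
      _ ≤ ∫ ω, Z t ω ∂μ := by
          refine integral_mono (hZA.add (hHi.sub hHE)) (hZi t ht.le) fun ω => ?_
          by_cases h : ω ∈ A
          · simp [h, hH]
          · simp only [hH, Set.indicator_of_notMem h, zero_add,
              Set.indicator_of_mem (Set.mem_compl h)]
            have h1 : Real.exp (E t ω) * (1 - E t ω) ≤ 1 := by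
              have := mul_le_mul_of_nonneg_left (Real.add_one_le_exp (-E t ω))
                (Real.exp_pos (E t ω)).le
              rw [← Real.exp_add, add_neg_cancel, Real.exp_zero] at this
              linarith
            nlinarith [mul_le_mul_of_nonneg_left h1 (hZ0 t ω)]
  have hall : ∀ t ≤ N, ∫ ω, Z t ω ∂μ ≤ 1 := fun t => by
    induction t with
    | zero => intro _; simp [hZ, stoppedProd]
    | succ t ih => exact fun ht => (hstep t ht).trans (ih (by omega))
  exact hall N le_rfl

/-- A maximal inequality of Ville type. -/
theorem measure_exists_log_le_sum_le {a : ℝ} (ha : 0 < a) {N : ℕ} {Y : ℕ → Ω → ℝ}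
    (hY : ∀ t < N, StronglyMeasurable[ℱ (t + 1)] (Y t)) (hb : ∀ t < N, ∀ᵐ ω ∂μ, |Y t ω| ≤ 1 / 2) :
    μ {ω | ∃ t ≤ N, Real.log a ≤
      ∑ k ∈ Finset.range t, ((μ[Y k | ℱ k]) ω - Y k ω - Y k ω ^ 2)} ≤ ENNReal.ofReal (1 / a) := by
  obtain ⟨hi, h1⟩ := integral_stoppedProd_le_one (a := a) hY hb
  have hM := mul_meas_ge_le_integral_of_nonneg (Filter.Eventually.of_forall fun ω =>
    stoppedProd_nonneg (fun _ => (Real.exp_pos _).le) N) hi a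
  have h2 : μ.real {ω | a ≤ stoppedProd a
      (fun k => Real.exp ((μ[Y k | ℱ k]) ω - Y k ω - Y k ω ^ 2)) N} ≤ 1 / a := by
    rw [le_div_iff₀' ha]; exact hM.trans h1
  refine (measure_mono ?_).trans (ENNReal.le_ofReal_iff_toReal_le (measure_ne_top _ _)
    (by positivity) |>.2 h2)
  rintro ω ⟨t, ht, h⟩
  refine le_stoppedProd ht ?_
  rw [← Real.exp_sum]
  exact (Real.log_le_iff_le_exp ha).1 h

/-- Time-uniform two-sided deviation bound for bounded martingale differences in terms of their
empirical second moments. -/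
theorem measure_not_forall_abs_sum_le {b δ : ℝ} (hb0 : 0 < b) (hδ : 0 < δ) {N : ℕ}
    {Y : ℕ → Ω → ℝ} (hY : ∀ t < N, StronglyMeasurable[ℱ (t + 1)] (Y t))
    (hb : ∀ t < N, ∀ᵐ ω ∂μ, |Y t ω| ≤ b) :
    μ {ω | ¬ ∀ t ≤ N, |∑ k ∈ Finset.range t, ((μ[Y k | ℱ k]) ω - Y k ω)| ≤
      2 * b * Real.log (2 / δ) + (∑ k ∈ Finset.range t, Y k ω ^ 2) / (2 * b)} ≤
      ENNReal.ofReal δ := by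
  -- Scaling by `±1/(2b)` brings the increments into `[-1/2, 1/2]`; each sign receives half of the
  -- failure probability.
  have hone : ∀ c : ℝ, |c| = 1 / (2 * b) → μ {ω | ∃ t ≤ N, Real.log (2 / δ) ≤
      ∑ k ∈ Finset.range t, (c * (μ[Y k | ℱ k]) ω - c * Y k ω - (c * Y k ω) ^ 2)} ≤
      ENNReal.ofReal (δ / 2) := fun c hc => by
    have h := measure_exists_log_le_sum_le (μ := μ) (ℱ := ℱ) (a := 2 / δ) (by positivity)
      (N := N) (Y := fun t => c • Y t) (fun t ht => (hY t ht).const_smul c) fun t ht => by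
        filter_upwards [hb t ht] with ω hω
        rw [Pi.smul_apply, smul_eq_mul, abs_mul, hc, one_div_mul_eq_div, div_le_iff₀ (by positivity)]
        linarith
    rw [one_div_div] at h
    refine (measure_mono_ae ?_).trans h
    have h1 : ∀ᵐ ω ∂μ, ∀ k, (μ[c • Y k | ℱ k]) ω = c * (μ[Y k | ℱ k]) ω :=
      ae_all_iff.2 fun k => condExp_smul c (Y k) (ℱ k) (μ := μ)
    filter_upwards [h1] with ω hω
    rintro ⟨t, ht, h2⟩
    refine ⟨t, ht, h2.trans_eq (Finset.sum_congr rfl fun k _ => ?_)⟩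
    simp [hω k]
  have hp : (0 : ℝ) < 1 / (2 * b) := by positivity
  refine (measure_mono ?_).trans ((measure_union_le _ _).trans
    (add_le_add (hone (1 / (2 * b)) (abs_of_pos hp)) (hone (-(1 / (2 * b)))
      (by rw [abs_neg, abs_of_pos hp])))) |>.trans_eq ?_
  · intro ω hω
    by_contra hno
    simp only [Set.mem_union, Set.mem_ofPred_eq, not_or, not_exists, not_and, not_le] at hno
    refine hω fun t ht => ?_
    have e1 := hno.1 t ht
    have e2 := hno.2 t ht
    set S := ∑ k ∈ Finset.range t, ((μ[Y k | ℱ k]) ω - Y k ω) with hS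
    set V := ∑ k ∈ Finset.range t, Y k ω ^ 2 with hV
    have f1 : ∀ c : ℝ, ∑ k ∈ Finset.range t,
        (c * (μ[Y k | ℱ k]) ω - c * Y k ω - (c * Y k ω) ^ 2) = c * S - c ^ 2 * V := fun c => by
      rw [hS, hV, Finset.mul_sum, Finset.mul_sum, ← Finset.sum_sub_distrib]
      exact Finset.sum_congr rfl fun k _ => by ring
    rw [f1] at e1 e2
    have f2 : ∀ z : ℝ, 1 / (2 * b) * z - (1 / (2 * b)) ^ 2 * V < Real.log (2 / δ) →
        z ≤ 2 * b * Real.log (2 / δ) + V / (2 * b) := fun z hz => by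
      have := mul_lt_mul_of_pos_left hz (by positivity : 0 < 2 * b)
      have e : 2 * b * (1 / (2 * b) * z - (1 / (2 * b)) ^ 2 * V) = z - V / (2 * b) := by
        field_simp
      linarith
    rw [abs_le']
    exact ⟨f2 _ e1, f2 _ (by rw [neg_sq] at e2; linarith)⟩
  · rw [← ENNReal.ofReal_add (by positivity) (by positivity), add_halves]

end Concentration

/-! ### Scalar sequences -/

section Scalar

theorem sum_mul_sq_sub_sq_le {a b : ℕ → ℝ} {D : ℝ} {n : ℕ} (hb0 : 0 ≤ b 0) (hb : Monotone b)
    (ha : ∀ t ≤ n, |a t| ≤ D) :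
    ∑ t ∈ Finset.range n, b t * (a t ^ 2 - a (t + 1) ^ 2) ≤ b n * D ^ 2 := by
  have hsq : ∀ t ≤ n, a t ^ 2 ≤ D ^ 2 := fun t ht => sq_le_sq' (abs_le.1 (ha t ht)).1
    (abs_le.1 (ha t ht)).2
  have hbn : ∀ n, 0 ≤ b n := fun n => hb0.trans (hb n.zero_le)
  -- The strengthened bound keeps `-b k * a k ^ 2`, which absorbs the next increment of `b`.
  have key : ∀ k ≤ n, ∑ t ∈ Finset.range k, b t * (a t ^ 2 - a (t + 1) ^ 2) ≤
      b k * (D ^ 2 - a k ^ 2) := fun k => by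
    induction k with
    | zero => intro _; simpa using mul_nonneg hb0 (sub_nonneg.2 (hsq 0 n.zero_le))
    | succ k ih =>
      intro hk
      rw [Finset.sum_range_succ]
      have h1 := ih (by omega)
      have h2 := mul_le_mul_of_nonneg_right (hb k.le_succ) (sub_nonneg.2 (hsq (k + 1) hk))
      linarith
  have h := key n le_rfl
  nlinarith [mul_nonneg (hbn n) (sq_nonneg (a n))]

/-- Abel summation bound for nonnegative nondecreasing weights. -/
theorem abs_sum_mul_le_of_monotone {y X : ℕ → ℝ} {A : ℝ} {n : ℕ} (hy0 : 0 ≤ y 0)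
    (hy : Monotone y) (hX : ∀ t ≤ n, |∑ k ∈ Finset.range t, X k| ≤ A) :
    |∑ k ∈ Finset.range n, y k * X k| ≤ 2 * y n * A := by
  have hyn : ∀ n, 0 ≤ y n := fun n => hy0.trans (hy n.zero_le)
  have hA : 0 ≤ A := (abs_nonneg _).trans (hX 0 n.zero_le)
  -- This is the cost of replacing all weights by the current one: each increment of `y` multiplies
  -- a partial sum of size at most `A`.
  have key : ∀ t ≤ n, |∑ k ∈ Finset.range t, y k * X k - y t * ∑ k ∈ Finset.range t, X k| ≤
      y t * A := fun t => by
    induction t with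
    | zero => intro _; simpa using mul_nonneg hy0 hA
    | succ t ih =>
      intro ht
      have h1 := ih (by omega)
      rw [Finset.sum_range_succ, show ∑ k ∈ Finset.range t, y k * X k + y t * X t -
          y (t + 1) * ∑ k ∈ Finset.range (t + 1), X k =
        (∑ k ∈ Finset.range t, y k * X k - y t * ∑ k ∈ Finset.range t, X k) -
          (y (t + 1) - y t) * ∑ k ∈ Finset.range (t + 1), X k by
        rw [Finset.sum_range_succ X]; ring]
      have h2 : |(y (t + 1) - y t) * ∑ k ∈ Finset.range (t + 1), X k| ≤
          (y (t + 1) - y t) * A := by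
        rw [abs_mul, abs_of_nonneg (sub_nonneg.2 (hy t.le_succ))]
        exact mul_le_mul_of_nonneg_left (hX _ ht) (sub_nonneg.2 (hy t.le_succ))
      refine (abs_sub _ _).trans ?_
      linarith
  have h1 := key n le_rfl
  have h2 : |y n * ∑ k ∈ Finset.range n, X k| ≤ y n * A := by
    rw [abs_mul, abs_of_nonneg (hyn n)]
    exact mul_le_mul_of_nonneg_left (hX n le_rfl) (hyn n)
  have h3 := abs_add_le (∑ k ∈ Finset.range n, y k * X k - y n * ∑ k ∈ Finset.range n, X k)
    (y n * ∑ k ∈ Finset.range n, X k)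
  rw [sub_add_cancel] at h3
  linarith

/-- The AdaGrad inequality: each term is at most twice the increment of the square root, and these
telescope. -/
theorem sum_sq_div_sqrt_sum_sq_le (a : ℕ → ℝ) (n : ℕ) :
    ∑ t ∈ Finset.range n, a t ^ 2 / √(∑ k ∈ Finset.range (t + 1), a k ^ 2) ≤
      2 * √(∑ k ∈ Finset.range n, a k ^ 2) := by
  induction n with
  | zero => simp
  | succ n ih =>
    rw [Finset.sum_range_succ]
    refine (add_le_add_left ih _).trans ?_
    set p := ∑ k ∈ Finset.range n, a k ^ 2 with hp
    rw [Finset.sum_range_succ, ← hp]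
    have hp0 : 0 ≤ p := Finset.sum_nonneg fun _ _ => sq_nonneg _
    rcases (Real.sqrt_nonneg (p + a n ^ 2)).eq_or_lt with h | h
    · have : √p ≤ √(p + a n ^ 2) := Real.sqrt_le_sqrt (by linarith [sq_nonneg (a n)])
      rw [← h] at this ⊢
      rw [div_zero]
      linarith
    · have h1 := Real.sq_sqrt hp0
      have h2 := Real.sq_sqrt (by positivity : 0 ≤ p + a n ^ 2)
      have h3 : a n ^ 2 / √(p + a n ^ 2) ≤ 2 * (√(p + a n ^ 2) - √p) := by
        rw [div_le_iff₀ h]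
        nlinarith [sq_nonneg (√(p + a n ^ 2) - √p)]
      linarith

theorem sum_sqrt_div_sqrt_le {w : ℕ → ℝ} (hw : Monotone w) (n : ℕ) :
    ∑ t ∈ Finset.range n, √(w t) / √(t + 1 : ℝ) ≤ 2 * √(n : ℝ) * √(w n) := by
  induction n with
  | zero => simp
  | succ n ih =>
    rw [Finset.sum_range_succ]
    have h1 : 0 < √(n + 1 : ℝ) := Real.sqrt_pos.2 (by positivity)
    have h2 := Real.sq_sqrt (by positivity : (0 : ℝ) ≤ n + 1)
    have h3 := Real.sq_sqrt (by positivity : (0 : ℝ) ≤ n)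
    have h4 : 1 / √(n + 1 : ℝ) ≤ 2 * (√(n + 1 : ℝ) - √(n : ℝ)) := by
      rw [div_le_iff₀ h1]
      nlinarith [sq_nonneg (√(n + 1 : ℝ) - √(n : ℝ))]
    have h5 := mul_le_mul_of_nonneg_left h4 (Real.sqrt_nonneg (w n))
    have h6 : √(w n) ≤ √(w (n + 1)) := Real.sqrt_le_sqrt (hw n.le_succ)
    have h7 := mul_le_mul_of_nonneg_left h6 h1.le
    push_cast
    rw [div_eq_mul_one_div]
    nlinarith

/-- For a positive nondecreasing sequence the largest ratio `∑_{i < t} y i / y t`, `t ≤ T`, is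
of order `T / (1 + log (y T / y 0))`. -/
theorem lt_mul_one_add_log {y : ℕ → ℝ} (hy0 : 0 < y 0) (hy : Monotone y) {T : ℕ} {R : ℝ}
    (hR0 : 0 < R) (hR : ∀ t ≤ T, ∑ i ∈ Finset.range t, y i / y t ≤ R) :
    (T : ℝ) < (Real.exp 1 * R + 1) * (1 + Real.log (y T / y 0)) := by
  have hpos : ∀ t, 0 < y t := fun t => hy0.trans_le (hy t.zero_le)
  -- A block length over which `y` must grow by a factor `e`: `n * y t ≤ ∑_{i<t+n} y i ≤ R * y (t +
  -- n)`. Hence at most `log (y T / y 0)` full blocks fit into `T`.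
  set n := ⌈Real.exp 1 * R⌉₊ with hn
  have hn1 : Real.exp 1 * R ≤ n := Nat.le_ceil _
  have hn2 : (n : ℝ) < Real.exp 1 * R + 1 := Nat.ceil_lt_add_one (by positivity)
  have hn0 : 0 < n := Nat.ceil_pos.2 (by positivity)
  have hgrow : ∀ t, t + n ≤ T → Real.exp 1 * y t ≤ y (t + n) := fun t ht => by
    have h1 := hR (t + n) ht
    rw [← Finset.sum_div, div_le_iff₀ (hpos _)] at h1
    have h2 : (n : ℝ) * y t ≤ ∑ i ∈ Finset.range (t + n), y i := by
      rw [Finset.sum_range_add]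
      have h3 : (n : ℝ) * y t ≤ ∑ i ∈ Finset.range n, y (t + i) := by
        simpa using Finset.card_nsmul_le_sum (Finset.range n) (fun i => y (t + i)) (y t)
          fun i _ => hy (Nat.le_add_right t i)
      linarith [Finset.sum_nonneg fun i (_ : i ∈ Finset.range t) => (hpos i).le]
    have h3 : R * (Real.exp 1 * y t) ≤ R * y (t + n) := by
      nlinarith [mul_le_mul_of_nonneg_right hn1 (hpos t).le]
    exact le_of_mul_le_mul_left h3 hR0
  have hblock : ∀ j : ℕ, j * n ≤ T → Real.exp j * y 0 ≤ y (j * n) := fun j => by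
    induction j with
    | zero => intro _; simp
    | succ j ih =>
      intro hj
      rw [add_mul, one_mul] at hj ⊢
      have h1 := ih (by omega)
      have h2 := hgrow _ hj
      rw [Nat.cast_succ, Real.exp_add]
      nlinarith [Real.exp_pos 1]
  have hj := hblock (T / n) (Nat.div_mul_le_self T n)
  have hlog : ((T / n : ℕ) : ℝ) ≤ Real.log (y T / y 0) := by
    rw [Real.le_log_iff_exp_le (div_pos (hpos _) hy0), le_div_iff₀ hy0]
    exact hj.trans (hy (Nat.div_mul_le_self T n))
  have hT : (T : ℝ) < n * ((T / n : ℕ) + 1) := by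
    exact_mod_cast Nat.lt_mul_div_succ T hn0
  have : (0 : ℝ) ≤ ((T / n : ℕ) : ℝ) := Nat.cast_nonneg _
  calc (T : ℝ) < n * ((T / n : ℕ) + 1) := hT
    _ ≤ (Real.exp 1 * R + 1) * (1 + Real.log (y T / y 0)) :=
      mul_le_mul hn2.le (by linarith) (by positivity) (by positivity)

end Scalar

/-! ### Moments and accumulators -/

/-- The admissible ranges of the moment parameters. -/
structure Params.Valid (P : Params) : Prop where
  β₁_nonneg : 0 ≤ P.β₁
  β₁_lt_one : P.β₁ < 1
  β₂_nonneg : 0 ≤ P.β₂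
  β₂_lt_one : P.β₂ < 1
  lam_nonneg : 0 ≤ P.lam
  lam_lt_one : P.lam < 1

section Moments

variable {d : ℕ} {P : Params} {c : Variant} {g : ℕ → Vec d}

theorem beta1_nonneg (hP : P.Valid) (t : ℕ) : 0 ≤ beta1 P t :=
  mul_nonneg hP.β₁_nonneg (pow_nonneg hP.lam_nonneg t)

theorem beta1_le (hP : P.Valid) (t : ℕ) : beta1 P t ≤ P.β₁ :=
  mul_le_of_le_one_right hP.β₁_nonneg (pow_le_one₀ hP.lam_nonneg hP.lam_lt_one.le)

theorem beta1_le_one (hP : P.Valid) (t : ℕ) : beta1 P t ≤ 1 :=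
  (beta1_le hP t).trans hP.β₁_lt_one.le

theorem v_nonneg (hP : P.Valid) (i : Fin d) (t : ℕ) : 0 ≤ v P g i t := by
  have h := sub_nonneg.2 hP.β₂_lt_one.le
  induction t with
  | zero => exact mul_nonneg h (sq_nonneg _)
  | succ t ih => exact add_nonneg (mul_nonneg hP.β₂_nonneg ih) (mul_nonneg h (sq_nonneg _))

theorem mul_sq_le_v (hP : P.Valid) (i : Fin d) (t : ℕ) : (1 - P.β₂) * g t i ^ 2 ≤ v P g i t := by
  cases t with
  | zero => exact le_rfl
  | succ t => exact le_add_of_nonneg_left (mul_nonneg hP.β₂_nonneg (v_nonneg hP i t))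

/-- The running maximum `max_{k ≤ t} v_k` of a coordinate of the second moment. -/
def vmax (P : Params) (g : ℕ → Vec d) (i : Fin d) (t : ℕ) : ℝ :=
  (Finset.range (t + 1)).sup' Finset.nonempty_range_add_one (v P g i)

theorem v_le_vmax (i : Fin d) {k t : ℕ} (h : k ≤ t) : v P g i k ≤ vmax P g i t :=
  Finset.le_sup' (v P g i) (Finset.mem_range.2 (by omega))

theorem vmax_mono (i : Fin d) : Monotone (vmax P g i) := fun a b h =>
  Finset.sup'_mono _ (Finset.range_mono (by omega)) _

theorem vmax_nonneg (hP : P.Valid) (i : Fin d) (t : ℕ) : 0 ≤ vmax P g i t :=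
  (v_nonneg hP i t).trans (v_le_vmax i le_rfl)

theorem s_case1_apply (t : ℕ) (i : Fin d) :
    s P .case1 g t i = √(∑ k ∈ Finset.range (t + 1), g k i ^ 2) := rfl

theorem s_case2_apply (t : ℕ) (i : Fin d) :
    s P .case2 g t i = √((t + 1 : ℝ) * vmax P g i t) := rfl

theorem s_nonneg (t : ℕ) (i : Fin d) : 0 ≤ s P c g t i := by
  cases c <;> exact Real.sqrt_nonneg _

theorem s_mono (hP : P.Valid) (i : Fin d) : Monotone fun t => s P c g t i := fun a b h => by
  cases c with
  | case1 =>
    exact Real.sqrt_le_sqrt (Finset.sum_le_sum_of_subset_of_nonneg (Finset.range_mono (by omega))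
      fun _ _ _ => sq_nonneg _)
  | case2 =>
    refine Real.sqrt_le_sqrt (mul_le_mul ?_ (vmax_mono i h) (vmax_nonneg hP i a) (by positivity))
    exact_mod_cast Nat.succ_le_succ h

/-- With `s_mono` and `mul_sum_sq_div_s_le`, this is what lets later estimates treat both variants
of `s` alike. In the second variant each of the `t + 1` summands is at most the running maximum. -/
theorem mul_sum_sq_le_s_sq (hP : P.Valid) (t : ℕ) (i : Fin d) :
    (1 - P.β₂) * ∑ k ∈ Finset.range (t + 1), g k i ^ 2 ≤ s P c g t i ^ 2 := by
  cases c with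
  | case1 =>
    have h : 0 ≤ ∑ k ∈ Finset.range (t + 1), g k i ^ 2 := Finset.sum_nonneg fun _ _ => sq_nonneg _
    rw [s_case1_apply, Real.sq_sqrt h]
    exact mul_le_of_le_one_left h (by linarith [hP.β₂_nonneg])
  | case2 =>
    rw [s_case2_apply, Real.sq_sqrt (mul_nonneg (by positivity) (vmax_nonneg hP i t)),
      Finset.mul_sum]
    refine (Finset.sum_le_card_nsmul _ _ (vmax P g i t) fun k hk => (mul_sq_le_v hP i k).trans
      (v_le_vmax i (by simpa [Nat.lt_succ_iff] using hk))).trans_eq ?_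
    simp

theorem mul_sq_le_s_sq (hP : P.Valid) (t : ℕ) (i : Fin d) :
    (1 - P.β₂) * g t i ^ 2 ≤ s P c g t i ^ 2 := by
  refine le_trans (mul_le_mul_of_nonneg_left ?_ (sub_nonneg.2 hP.β₂_lt_one.le))
    (mul_sum_sq_le_s_sq hP t i)
  exact Finset.single_le_sum (f := fun k => g k i ^ 2) (fun _ _ => sq_nonneg _)
    (Finset.self_mem_range_succ t)

theorem mul_sum_sq_div_s_le (hP : P.Valid) (n : ℕ) (i : Fin d) :
    (1 - P.β₂) * ∑ t ∈ Finset.range n, g t i ^ 2 / s P c g t i ≤ 2 * s P c g n i := by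
  cases c with
  | case1 =>
    have h0 : 0 ≤ ∑ t ∈ Finset.range n, g t i ^ 2 / s P .case1 g t i :=
      Finset.sum_nonneg fun t _ => div_nonneg (sq_nonneg _) (s_nonneg t i)
    refine (mul_le_of_le_one_left h0 (by linarith [hP.β₂_nonneg])).trans
      ((sum_sq_div_sqrt_sum_sq_le (fun k => g k i) n).trans ?_)
    refine mul_le_mul_of_nonneg_left (Real.sqrt_le_sqrt ?_) two_pos.le
    exact Finset.sum_le_sum_of_subset_of_nonneg (Finset.range_mono n.le_succ)
      fun _ _ _ => sq_nonneg _
  | case2 =>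
    have h1 : ∀ t ∈ Finset.range n, (1 - P.β₂) * (g t i ^ 2 / s P .case2 g t i) ≤
        √(vmax P g i t) / √(t + 1 : ℝ) := fun t _ => by
      rw [s_case2_apply, Real.sqrt_mul (by positivity), ← mul_div_assoc]
      have h2 := (mul_sq_le_v hP i t).trans (v_le_vmax (P := P) (g := g) i le_rfl)
      have h3 : (0 : ℝ) < √(t + 1 : ℝ) := Real.sqrt_pos.2 (by positivity)
      -- If the maximum vanishes, the quotient on the left is `0` by the convention for division by
      -- zero.
      rcases (Real.sqrt_nonneg (vmax P g i t)).eq_or_lt with h | h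
      · simp [← h]
      · rw [div_le_div_iff₀ (by positivity) h3]
        nlinarith [Real.sq_sqrt (vmax_nonneg (g := g) hP i t)]
    rw [Finset.mul_sum]
    refine (Finset.sum_le_sum h1).trans ((sum_sqrt_div_sqrt_le (vmax_mono i) n).trans ?_)
    rw [s_case2_apply, Real.sqrt_mul (by positivity), mul_assoc]
    gcongr
    linarith

theorem m_zero_apply (i : Fin d) : m P g 0 i = (1 - beta1 P 0) * g 0 i := rfl

theorem m_succ_apply (t : ℕ) (i : Fin d) :
    m P g (t + 1) i = beta1 P (t + 1) * m P g t i + (1 - beta1 P (t + 1)) * g (t + 1) i := rfl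

theorem m_sq_zero_le (hP : P.Valid) (i : Fin d) : m P g 0 i ^ 2 ≤ g 0 i ^ 2 := by
  rw [m_zero_apply, mul_pow]
  have h1 := beta1_nonneg hP 0
  have h2 := beta1_le_one hP 0
  exact mul_le_of_le_one_left (sq_nonneg _) (pow_le_one₀ (by linarith) (by linarith))

theorem m_sq_succ_le (hP : P.Valid) (t : ℕ) (i : Fin d) :
    m P g (t + 1) i ^ 2 ≤ beta1 P (t + 1) * m P g t i ^ 2 +
      (1 - beta1 P (t + 1)) * g (t + 1) i ^ 2 := by
  rw [m_succ_apply]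
  have h1 := beta1_nonneg hP (t + 1)
  have h2 := beta1_le_one hP (t + 1)
  nlinarith [mul_nonneg (mul_nonneg h1 (sub_nonneg.2 h2)) (sq_nonneg (m P g t i - g (t + 1) i))]

theorem mul_m_sq_le_s_sq (hP : P.Valid) (t : ℕ) (i : Fin d) :
    (1 - P.β₂) * m P g t i ^ 2 ≤ s P c g t i ^ 2 := by
  have hc := sub_nonneg.2 hP.β₂_lt_one.le
  induction t with
  | zero =>
    exact (mul_le_mul_of_nonneg_left (m_sq_zero_le hP i) hc).trans (mul_sq_le_s_sq hP 0 i)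
  | succ t ih =>
    have h0 : s P c g t i ^ 2 ≤ s P c g (t + 1) i ^ 2 :=
      pow_le_pow_left₀ (s_nonneg t i) (s_mono hP i t.le_succ) 2
    have h1 := mul_le_mul_of_nonneg_left (m_sq_succ_le (g := g) hP t i) hc
    have h2 := mul_le_mul_of_nonneg_left (ih.trans h0) (beta1_nonneg hP (t + 1))
    have h3 := mul_le_mul_of_nonneg_left (mul_sq_le_s_sq (c := c) (g := g) hP (t + 1) i)
      (sub_nonneg.2 (beta1_le_one hP (t + 1)))
    linarith

/-- A vanishing accumulator forces a vanishing step, so the convention `0/0 = 0` never hides a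
nonzero numerator. -/
theorem m_eq_zero_of_s_eq_zero (hP : P.Valid) {t : ℕ} {i : Fin d} (h : s P c g t i = 0) :
    m P g t i = 0 := by
  have h1 := mul_m_sq_le_s_sq (c := c) (g := g) hP t i
  rw [h, zero_pow two_ne_zero] at h1
  exact pow_eq_zero_iff two_ne_zero |>.1
    (le_antisymm (nonpos_of_mul_nonpos_right h1 (sub_pos.2 hP.β₂_lt_one)) (sq_nonneg _))

/-- Convexity of the square and monotonicity of `s` give `q (t+1) ≤ β₁ * q t + g²/s`; summing, the
`β₁` term is absorbed on the left. -/
theorem mul_sum_m_sq_div_s_le (hP : P.Valid) (n : ℕ) (i : Fin d) :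
    (1 - P.β₁) * ∑ t ∈ Finset.range n, m P g t i ^ 2 / s P c g t i ≤
      ∑ t ∈ Finset.range n, g t i ^ 2 / s P c g t i := by
  set q : ℕ → ℝ := fun t => m P g t i ^ 2 / s P c g t i with hq
  have hq0 : ∀ t, 0 ≤ q t := fun t => div_nonneg (sq_nonneg _) (s_nonneg t i)
  have hstep : ∀ t, q (t + 1) ≤ P.β₁ * q t + g (t + 1) i ^ 2 / s P c g (t + 1) i := fun t => by
    have h1 : m P g t i ^ 2 / s P c g (t + 1) i ≤ q t := by
      rcases (s_nonneg (P := P) (c := c) (g := g) t i).eq_or_lt with h | h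
      · simp [hq, m_eq_zero_of_s_eq_zero hP h.symm]
      · exact div_le_div_of_nonneg_left (sq_nonneg _) h (s_mono hP i t.le_succ)
    have h2 : m P g (t + 1) i ^ 2 ≤ P.β₁ * m P g t i ^ 2 + g (t + 1) i ^ 2 :=
      (m_sq_succ_le hP t i).trans (add_le_add
        (mul_le_mul_of_nonneg_right (beta1_le hP _) (sq_nonneg _))
        (mul_le_of_le_one_left (sq_nonneg _) (by linarith [beta1_nonneg hP (t + 1)])))
    calc q (t + 1) ≤ (P.β₁ * m P g t i ^ 2 + g (t + 1) i ^ 2) / s P c g (t + 1) i :=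
          div_le_div_of_nonneg_right h2 (s_nonneg _ i)
      _ = P.β₁ * (m P g t i ^ 2 / s P c g (t + 1) i) + g (t + 1) i ^ 2 / s P c g (t + 1) i := by
          ring
      _ ≤ _ := by gcongr; exact hP.β₁_nonneg
  have key : ∀ n, ∑ t ∈ Finset.range (n + 1), q t ≤ P.β₁ * ∑ t ∈ Finset.range n, q t +
      ∑ t ∈ Finset.range (n + 1), g t i ^ 2 / s P c g t i := fun n => by
    induction n with
    | zero =>
      simpa [hq] using div_le_div_of_nonneg_right (m_sq_zero_le (g := g) hP i)
        (s_nonneg (P := P) (c := c) (g := g) 0 i)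
    | succ n ih =>
      rw [Finset.sum_range_succ q (n + 1), Finset.sum_range_succ q n,
        Finset.sum_range_succ _ (n + 1), mul_add]
      rw [Finset.sum_range_succ q n] at ih
      linarith [hstep n]
  cases n with
  | zero => simp
  | succ n =>
    have h1 := key n
    have h2 : P.β₁ * ∑ t ∈ Finset.range n, q t ≤ P.β₁ * ∑ t ∈ Finset.range (n + 1), q t := by
      refine mul_le_mul_of_nonneg_left ?_ hP.β₁_nonneg
      rw [Finset.sum_range_succ]
      linarith [hq0 n]
    linarith

theorem norm_m_le (hP : P.Valid) {G : ℝ} {t : ℕ} (hg : ∀ k ≤ t, ‖g k‖ ≤ G) : ‖m P g t‖ ≤ G := by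
  induction t with
  | zero =>
    have h1 := beta1_nonneg hP 0
    have h2 := beta1_le_one hP 0
    rw [m, norm_smul, Real.norm_of_nonneg (sub_nonneg.2 h2)]
    exact (mul_le_of_le_one_left (norm_nonneg _) (by linarith)).trans (hg 0 le_rfl)
  | succ t ih =>
    have h1 := beta1_nonneg hP (t + 1)
    have h2 := beta1_le_one hP (t + 1)
    rw [m]
    refine (norm_add_le _ _).trans ?_
    rw [norm_smul, norm_smul, Real.norm_of_nonneg h1, Real.norm_of_nonneg (sub_nonneg.2 h2)]
    have h3 := mul_le_mul_of_nonneg_left (ih fun k hk => hg k (by omega)) h1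
    have h4 := mul_le_mul_of_nonneg_left (hg (t + 1) le_rfl) (sub_nonneg.2 h2)
    linarith

/-- The momentum error `⟪g_t - m_t, w⟫` decays geometrically. -/
theorem abs_inner_sub_m_le (hP : P.Valid) {G : ℝ} {t : ℕ} (hg : ∀ k ≤ t, ‖g k‖ ≤ G) (w : Vec d) :
    |inner ℝ (g t - m P g t) w| ≤ beta1 P t * (2 * G) * ‖w‖ := by
  have hG : 0 ≤ G := (norm_nonneg _).trans (hg t le_rfl)
  refine (abs_real_inner_le_norm _ _).trans (mul_le_mul_of_nonneg_right ?_ (norm_nonneg _))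
  have hb := beta1_nonneg hP t
  cases t with
  | zero =>
    rw [m, show g 0 - (1 - beta1 P 0) • g 0 = beta1 P 0 • g 0 by module, norm_smul,
      Real.norm_of_nonneg hb]
    exact mul_le_mul_of_nonneg_left (by linarith [hg 0 le_rfl]) hb
  | succ t =>
    rw [m, show g (t + 1) - (beta1 P (t + 1) • m P g t + (1 - beta1 P (t + 1)) • g (t + 1)) =
      beta1 P (t + 1) • (g (t + 1) - m P g t) by module, norm_smul, Real.norm_of_nonneg hb]
    refine mul_le_mul_of_nonneg_left ((norm_sub_le _ _).trans ?_) hb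
    linarith [hg (t + 1) le_rfl, norm_m_le hP fun k hk => hg k (Nat.le_succ_of_le hk)]

theorem sum_beta1_le (hP : P.Valid) (n : ℕ) :
    ∑ t ∈ Finset.range n, beta1 P t ≤ 1 / (1 - P.lam) := by
  have h1 : ∑ t ∈ Finset.range n, P.lam ^ t ≤ 1 / (1 - P.lam) := by
    rw [one_div, ← tsum_geometric_of_lt_one hP.lam_nonneg hP.lam_lt_one]
    exact (summable_geometric_of_lt_one hP.lam_nonneg hP.lam_lt_one).sum_le_tsum _
      fun k _ => pow_nonneg hP.lam_nonneg k
  refine le_trans (Finset.sum_le_sum fun t _ => ?_) h1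
  exact mul_le_of_le_one_left (pow_nonneg hP.lam_nonneg t) hP.β₁_lt_one.le

theorem sum_s_le_norm (t : ℕ) : ∑ i, s P c g t i ≤ √(d : ℝ) * ‖s P c g t‖ := by
  refine Real.le_sqrt_of_sq_le ?_ |>.trans_eq
    (by rw [Real.sqrt_mul (Nat.cast_nonneg d), Real.sqrt_sq (norm_nonneg _)] :
      √(d * ‖s P c g t‖ ^ 2) = _)
  rw [EuclideanSpace.real_norm_sq_eq]
  simpa using sq_sum_le_card_mul_sum_sq (s := Finset.univ) (f := fun i => s P c g t i)

theorem mul_sum_norm_sq_le (hP : P.Valid) (t : ℕ) :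
    (1 - P.β₂) * ∑ k ∈ Finset.range t, ‖g k‖ ^ 2 ≤ ‖s P c g t‖ ^ 2 := by
  have h1 : ∑ k ∈ Finset.range t, ‖g k‖ ^ 2 ≤ ∑ k ∈ Finset.range (t + 1), ‖g k‖ ^ 2 :=
    Finset.sum_le_sum_of_subset_of_nonneg (Finset.range_mono t.le_succ) fun _ _ _ => sq_nonneg _
  refine (mul_le_mul_of_nonneg_left h1 (sub_nonneg.2 hP.β₂_lt_one.le)).trans ?_
  simp_rw [EuclideanSpace.real_norm_sq_eq]
  rw [Finset.sum_comm, Finset.mul_sum]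
  exact Finset.sum_le_sum fun i _ => mul_sum_sq_le_s_sq hP t i

end Moments

/-! ### The iterates -/

section Iterates

variable {d : ℕ} {P : Params} {c : Variant} {η₀ κ : ℝ} {g : ℕ → Vec d} {x₀ xs : Vec d}

theorem x_zero : x P c η₀ κ g x₀ 0 = x₀ := rfl

theorem x_succ_apply (t : ℕ) (i : Fin d) :
    x P c η₀ κ g x₀ (t + 1) i =
      x P c η₀ κ g x₀ t i - η P c η₀ κ g x₀ t * (m P g t i / (κ + s P c g t i)) := rfl

theorem η_zero : η P c η₀ κ g x₀ 0 = η₀ := rfl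

theorem η_succ (t : ℕ) : η P c η₀ κ g x₀ (t + 1) =
    max (η P c η₀ κ g x₀ t) (‖x P c η₀ κ g x₀ (t + 1) - x₀‖ / √(d : ℝ)) := rfl

theorem η_mono : Monotone (η P c η₀ κ g x₀) :=
  monotone_nat_of_le_succ fun _ => le_max_left _ _

theorem le_η (t : ℕ) : η₀ ≤ η P c η₀ κ g x₀ t := η_mono t.zero_le

theorem norm_le_sqrt_mul_linf (y : Vec d) : ‖y‖ ≤ √(d : ℝ) * linf y := by
  rw [EuclideanSpace.norm_eq]
  refine Real.sqrt_le_iff.2 ⟨mul_nonneg (Real.sqrt_nonneg _) (norm_nonneg _), ?_⟩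
  rw [mul_pow, Real.sq_sqrt (Nat.cast_nonneg d)]
  refine (Finset.sum_le_card_nsmul _ _ (linf y ^ 2) fun i _ => ?_).trans_eq (by simp)
  exact pow_le_pow_left₀ (norm_nonneg _) (norm_le_pi_norm (WithLp.ofLp y) i) 2

theorem linf_le_D {k t : ℕ} (h : k ≤ t) :
    linf (x P c η₀ κ g x₀ k - xs) ≤ D P c η₀ κ g x₀ xs t :=
  Finset.le_sup' (fun k => linf (x P c η₀ κ g x₀ k - xs)) (Finset.mem_range.2 (by omega))

theorem D_nonneg (t : ℕ) : 0 ≤ D P c η₀ κ g x₀ xs t :=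
  (norm_nonneg _).trans (linf_le_D (le_refl t))

theorem D_mono : Monotone (D P c η₀ κ g x₀ xs) := fun a b h =>
  Finset.sup'_mono _ (Finset.range_mono (by omega)) _

theorem abs_x_sub_le_D {k t : ℕ} (h : k ≤ t) (i : Fin d) :
    |x P c η₀ κ g x₀ k i - xs i| ≤ D P c η₀ κ g x₀ xs t :=
  (norm_le_pi_norm (WithLp.ofLp (x P c η₀ κ g x₀ k - xs)) i).trans (linf_le_D h)

theorem norm_x_sub_le {k t : ℕ} (h : k ≤ t) :
    ‖x P c η₀ κ g x₀ k - xs‖ ≤ √(d : ℝ) * D P c η₀ κ g x₀ xs t :=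
  (norm_le_sqrt_mul_linf _).trans (mul_le_mul_of_nonneg_left (linf_le_D h) (Real.sqrt_nonneg _))

/-- The factor 2 is the triangle inequality through `xs`: `x_k` and `x₀` both lie within `√d * D` of
it. -/
theorem η_le_two_mul_max (hη : 0 ≤ η₀) (t : ℕ) :
    η P c η₀ κ g x₀ t ≤ 2 * max (D P c η₀ κ g x₀ xs t) η₀ := by
  have key : ∀ k ≤ t, η P c η₀ κ g x₀ k ≤ 2 * max (D P c η₀ κ g x₀ xs t) η₀ := fun k => by
    induction k with
    | zero => intro _; rw [η_zero]; linarith [le_max_right (D P c η₀ κ g x₀ xs t) η₀]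
    | succ k ih =>
      intro hk
      rw [η_succ]
      refine max_le (ih (by omega)) (le_trans ?_
        (mul_le_mul_of_nonneg_left (le_max_left (D P c η₀ κ g x₀ xs t) η₀) two_pos.le))
      refine div_le_of_le_mul₀ (Real.sqrt_nonneg _) (mul_nonneg two_pos.le (D_nonneg t)) ?_
      have h1 := norm_x_sub_le (P := P) (c := c) (η₀ := η₀) (κ := κ) (g := g) (x₀ := x₀)
        (xs := xs) hk
      have h2 := norm_x_sub_le (P := P) (c := c) (η₀ := η₀) (κ := κ) (g := g) (x₀ := x₀)
        (xs := xs) t.zero_le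
      have h3 := norm_sub_le_norm_sub_add_norm_sub (x P c η₀ κ g x₀ (k + 1)) xs x₀
      rw [norm_sub_rev xs x₀] at h3
      rw [x_zero] at h2
      linarith
  exact key t le_rfl

theorem sum_mul_m_mul_le (hP : P.Valid) (hη : 0 ≤ η₀) (hκ : 0 ≤ κ) (n : ℕ) (i : Fin d) :
    ∑ t ∈ Finset.range n,
        η P c η₀ κ g x₀ t * (m P g t i * (x P c η₀ κ g x₀ t i - xs i)) ≤
      (κ + s P c g n i) / 2 * D P c η₀ κ g x₀ xs n ^ 2 +
        η P c η₀ κ g x₀ n ^ 2 * (s P c g n i / ((1 - P.β₁) * (1 - P.β₂))) := by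
  have h1 := sub_pos.2 hP.β₁_lt_one
  have h2 := sub_pos.2 hP.β₂_lt_one
  set a : ℕ → ℝ := fun t => x P c η₀ κ g x₀ t i - xs i with ha
  set b : ℕ → ℝ := fun t => κ + s P c g t i with hb
  have hb0 : ∀ t, 0 ≤ b t := fun t => add_nonneg hκ (s_nonneg t i)
  have hbm : Monotone b := fun t t' h => add_le_add_right (s_mono hP i h) κ
  have hterm : ∀ t ∈ Finset.range n, η P c η₀ κ g x₀ t * (m P g t i * a t) ≤
      b t * (a t ^ 2 - a (t + 1) ^ 2) / 2 +
        η P c η₀ κ g x₀ n ^ 2 / 2 * (m P g t i ^ 2 / s P c g t i) := fun t ht => by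
    have hstep : a (t + 1) = a t - η P c η₀ κ g x₀ t * (m P g t i / b t) := by
      simp only [ha, hb, x_succ_apply]; ring
    rcases (s_nonneg (P := P) (c := c) (g := g) t i).eq_or_lt with h | h
    · rw [hstep, m_eq_zero_of_s_eq_zero hP h.symm]
      simp
    · have hbt : 0 < b t := add_pos_of_nonneg_of_pos hκ h
      -- Expanding the square of the update: the weight `η_t` cancels the step size, so the
      -- telescoping weight is `b t`, monotone, and not `b t / η_t`.
      have e : η P c η₀ κ g x₀ t * (m P g t i * a t) = b t * (a t ^ 2 - a (t + 1) ^ 2) / 2 +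
          η P c η₀ κ g x₀ t ^ 2 / 2 * (m P g t i ^ 2 / b t) := by
        rw [hstep]; field_simp; ring
      rw [e]
      have h3 : m P g t i ^ 2 / b t ≤ m P g t i ^ 2 / s P c g t i :=
        div_le_div_of_nonneg_left (sq_nonneg _) h (le_add_of_nonneg_left hκ)
      have h4 : η P c η₀ κ g x₀ t ^ 2 / 2 ≤ η P c η₀ κ g x₀ n ^ 2 / 2 :=
        div_le_div_of_nonneg_right (pow_le_pow_left₀ (hη.trans (le_η t))
          (η_mono (Finset.mem_range.1 ht).le) 2) two_pos.le
      exact add_le_add_right (mul_le_mul h4 h3 (by positivity) (by positivity)) _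
  refine (Finset.sum_le_sum hterm).trans ?_
  rw [Finset.sum_add_distrib, ← Finset.mul_sum, ← Finset.sum_div]
  have h5 := sum_mul_sq_sub_sq_le (hb0 0) hbm (n := n) fun t ht =>
    abs_x_sub_le_D (P := P) (c := c) (η₀ := η₀) (κ := κ) (g := g) (x₀ := x₀) (xs := xs) ht i
  have h6 : ∑ t ∈ Finset.range n, m P g t i ^ 2 / s P c g t i ≤
      2 * (s P c g n i / ((1 - P.β₁) * (1 - P.β₂))) := by
    rw [← mul_div_assoc, le_div_iff₀ (by positivity)]
    have h7 := mul_le_mul_of_nonneg_left (mul_sum_m_sq_div_s_le (c := c) (g := g) hP n i) h2.le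
    have h8 := mul_sum_sq_div_s_le (c := c) (g := g) hP n i
    linarith
  have h9 := mul_le_mul_of_nonneg_left h6
    (by positivity : 0 ≤ η P c η₀ κ g x₀ n ^ 2 / 2)
  linarith

theorem sum_mul_inner_m_le (hP : P.Valid) (hη : 0 ≤ η₀) (hκ : 0 ≤ κ) {B : ℝ} {n : ℕ}
    (hκB : κ * √(d : ℝ) ≤ B) (hs : ‖s P c g n‖ ≤ B) :
    ∑ t ∈ Finset.range n,
        η P c η₀ κ g x₀ t * inner ℝ (m P g t) (x P c η₀ κ g x₀ t - xs) ≤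
      √(d : ℝ) * B * (D P c η₀ κ g x₀ xs n ^ 2 +
        η P c η₀ κ g x₀ n ^ 2 / ((1 - P.β₁) * (1 - P.β₂))) := by
  have h1 := sub_pos.2 hP.β₁_lt_one
  have h2 := sub_pos.2 hP.β₂_lt_one
  have e : ∀ t, η P c η₀ κ g x₀ t * inner ℝ (m P g t) (x P c η₀ κ g x₀ t - xs) =
      ∑ i, η P c η₀ κ g x₀ t * (m P g t i * (x P c η₀ κ g x₀ t i - xs i)) := fun t => by
    rw [PiLp.inner_apply, Finset.mul_sum]
    refine Finset.sum_congr rfl fun i _ => ?_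
    simp [mul_comm]
  simp_rw [e]
  rw [Finset.sum_comm]
  refine (Finset.sum_le_sum fun i _ => sum_mul_m_mul_le (xs := xs) hP hη hκ n i).trans ?_
  have hsum : ∑ i, s P c g n i ≤ √(d : ℝ) * B :=
    (sum_s_le_norm n).trans (mul_le_mul_of_nonneg_left hs (Real.sqrt_nonneg _))
  -- Summing the stabilizer over coordinates costs `d * κ`; its assumed smallness makes this
  -- comparable to `∑ s_i`.
  have hκs : (d : ℝ) * κ ≤ √(d : ℝ) * B := by
    have := mul_le_mul_of_nonneg_left hκB (Real.sqrt_nonneg (d : ℝ))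
    nlinarith [Real.mul_self_sqrt (Nat.cast_nonneg (α := ℝ) d)]
  rw [Finset.sum_add_distrib, ← Finset.sum_mul, ← Finset.mul_sum, ← Finset.sum_div,
    ← Finset.sum_div, Finset.sum_add_distrib, Finset.sum_const, Finset.card_univ,
    Fintype.card_fin, nsmul_eq_mul, mul_add]
  refine add_le_add (mul_le_mul_of_nonneg_right (by linarith) (sq_nonneg _)) ?_
  rw [mul_div_assoc', mul_div_assoc', mul_comm]
  gcongr

/-- The direction from the comparison point to the iterate, scaled to norm at most one by a
nondecreasing factor. -/
def dir (P : Params) (c : Variant) (η₀ κ : ℝ) (g : ℕ → Vec d) (x₀ xs : Vec d) (t : ℕ) : Vec d :=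
  (√(d : ℝ) * D P c η₀ κ g x₀ xs t)⁻¹ • (x P c η₀ κ g x₀ t - xs)

theorem norm_dir_le_one (t : ℕ) : ‖dir P c η₀ κ g x₀ xs t‖ ≤ 1 := by
  have h : 0 ≤ √(d : ℝ) * D P c η₀ κ g x₀ xs t := mul_nonneg (Real.sqrt_nonneg _) (D_nonneg t)
  rw [dir, norm_smul, Real.norm_of_nonneg (inv_nonneg.2 h), inv_mul_eq_div]
  exact div_le_one_of_le₀ (norm_x_sub_le le_rfl) h

theorem smul_dir (t : ℕ) : (√(d : ℝ) * D P c η₀ κ g x₀ xs t) • dir P c η₀ κ g x₀ xs t =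
    x P c η₀ κ g x₀ t - xs := by
  rcases eq_or_ne (√(d : ℝ) * D P c η₀ κ g x₀ xs t) 0 with h | h
  · have h1 := norm_x_sub_le (P := P) (c := c) (η₀ := η₀) (κ := κ) (g := g) (x₀ := x₀)
      (xs := xs) (le_refl t)
    rw [h] at h1 ⊢
    rw [zero_smul, norm_le_zero_iff.1 h1]
  · rw [dir, smul_inv_smul₀ h]

/-- Jensen's inequality and the subgradient inequality for the weighted average. -/
theorem xbar_sub_le_div {f : Vec d → ℝ} (hf : ConvexOn ℝ Set.univ f) (hη : 0 < η₀) {n : ℕ}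
    (hn : 0 < n) {h : ℕ → Vec d}
    (hh : ∀ t < n, h t ∈ subdifferential f (x P c η₀ κ g x₀ t)) :
    f (xbar P c η₀ κ g x₀ n) - f xs ≤
      (∑ t ∈ Finset.range n, η P c η₀ κ g x₀ t * inner ℝ (x P c η₀ κ g x₀ t - xs) (h t)) /
        ∑ t ∈ Finset.range n, η P c η₀ κ g x₀ t := by
  have hpos : ∀ t, 0 < η P c η₀ κ g x₀ t := fun t => hη.trans_le (le_η t)
  have hS : 0 < ∑ t ∈ Finset.range n, η P c η₀ κ g x₀ t :=
    Finset.sum_pos (fun t _ => hpos t) (Finset.nonempty_range_iff.2 hn.ne')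
  have h1 := hf.map_centerMass_le (t := Finset.range n) (w := η P c η₀ κ g x₀)
    (p := x P c η₀ κ g x₀) (fun t _ => (hpos t).le) hS fun _ _ => Set.mem_univ _
  have h2 : f (xbar P c η₀ κ g x₀ n) ≤
      (∑ t ∈ Finset.range n, η P c η₀ κ g x₀ t)⁻¹ *
        ∑ t ∈ Finset.range n, η P c η₀ κ g x₀ t * f (x P c η₀ κ g x₀ t) := h1
  rw [inv_mul_eq_div, le_div_iff₀ hS] at h2
  rw [le_div_iff₀ hS, sub_mul]
  have h3 : ∑ t ∈ Finset.range n, η P c η₀ κ g x₀ t * f (x P c η₀ κ g x₀ t) -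
      f xs * ∑ t ∈ Finset.range n, η P c η₀ κ g x₀ t ≤
      ∑ t ∈ Finset.range n, η P c η₀ κ g x₀ t * inner ℝ (x P c η₀ κ g x₀ t - xs) (h t) := by
    rw [Finset.mul_sum, ← Finset.sum_sub_distrib]
    refine Finset.sum_le_sum fun t ht => ?_
    have h4 := hh t (Finset.mem_range.1 ht) xs
    rw [← neg_sub, inner_neg_right, real_inner_comm] at h4
    have := mul_le_mul_of_nonneg_left h4 (hpos t).le
    linarith
  linarith

theorem sum_mul_inner_le (hP : P.Valid) (hη : 0 ≤ η₀) (hκ : 0 ≤ κ) {A B G : ℝ} {n : ℕ}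
    {h : ℕ → Vec d} (hκB : κ * √(d : ℝ) ≤ B) (hs : ‖s P c g n‖ ≤ B)
    (hg : ∀ t < n, ‖g t‖ ≤ G) (hG : 0 ≤ G)
    (hdev : ∀ t ≤ n, |∑ k ∈ Finset.range t, (inner ℝ (dir P c η₀ κ g x₀ xs k) (h k) -
      inner ℝ (dir P c η₀ κ g x₀ xs k) (g k))| ≤ A) :
    ∑ t ∈ Finset.range n, η P c η₀ κ g x₀ t * inner ℝ (x P c η₀ κ g x₀ t - xs) (h t) ≤
      √(d : ℝ) * B * (D P c η₀ κ g x₀ xs n ^ 2 +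
        η P c η₀ κ g x₀ n ^ 2 / ((1 - P.β₁) * (1 - P.β₂))) +
      η P c η₀ κ g x₀ n * (2 * G) * (√(d : ℝ) * D P c η₀ κ g x₀ xs n) / (1 - P.lam) +
      2 * (η P c η₀ κ g x₀ n * (√(d : ℝ) * D P c η₀ κ g x₀ xs n)) * A := by
  have hpos : ∀ t, 0 ≤ η P c η₀ κ g x₀ t := fun t => hη.trans (le_η t)
  set r : ℕ → ℝ := fun t => √(d : ℝ) * D P c η₀ κ g x₀ xs t with hr
  have hr0 : ∀ t, 0 ≤ r t := fun t => mul_nonneg (Real.sqrt_nonneg _) (D_nonneg t)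
  have hrm : Monotone r := fun a b hab =>
    mul_le_mul_of_nonneg_left (D_mono hab) (Real.sqrt_nonneg _)
  have hdecomp : ∀ t, η P c η₀ κ g x₀ t * inner ℝ (x P c η₀ κ g x₀ t - xs) (h t) =
      η P c η₀ κ g x₀ t * inner ℝ (m P g t) (x P c η₀ κ g x₀ t - xs) +
      η P c η₀ κ g x₀ t * inner ℝ (g t - m P g t) (x P c η₀ κ g x₀ t - xs) +
      (η P c η₀ κ g x₀ t * r t) * (inner ℝ (dir P c η₀ κ g x₀ xs t) (h t) -
        inner ℝ (dir P c η₀ κ g x₀ xs t) (g t)) := fun t => by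
    have e : ∀ z : Vec d, r t * inner ℝ (dir P c η₀ κ g x₀ xs t) z =
        inner ℝ (x P c η₀ κ g x₀ t - xs) z := fun z => by
      rw [← smul_dir, real_inner_smul_left]
    rw [mul_assoc, mul_sub (r t), e, e, inner_sub_left (g t), real_inner_comm _ (m P g t),
      real_inner_comm _ (g t)]
    ring
  simp_rw [hdecomp]
  rw [Finset.sum_add_distrib, Finset.sum_add_distrib]
  refine add_le_add (add_le_add (sum_mul_inner_m_le hP hη hκ hκB hs) ?_) ?_
  · have h1 : ∀ t ∈ Finset.range n,
        η P c η₀ κ g x₀ t * inner ℝ (g t - m P g t) (x P c η₀ κ g x₀ t - xs) ≤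
          beta1 P t * (η P c η₀ κ g x₀ n * (2 * G) * r n) := fun t ht => by
      have htn := Finset.mem_range.1 ht
      have h2 := (le_abs_self _).trans (abs_inner_sub_m_le hP (fun k hk => hg k (hk.trans_lt htn))
        (x P c η₀ κ g x₀ t - xs))
      have h3 : inner ℝ (g t - m P g t) (x P c η₀ κ g x₀ t - xs) ≤ beta1 P t * (2 * G) * r n :=
        h2.trans (mul_le_mul_of_nonneg_left (norm_x_sub_le htn.le)
          (mul_nonneg (beta1_nonneg hP t) (by positivity)))
      calc _ ≤ η P c η₀ κ g x₀ t * (beta1 P t * (2 * G) * r n) :=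
            mul_le_mul_of_nonneg_left h3 (hpos t)
        _ ≤ η P c η₀ κ g x₀ n * (beta1 P t * (2 * G) * r n) :=
            mul_le_mul_of_nonneg_right (η_mono htn.le)
              (mul_nonneg (mul_nonneg (beta1_nonneg hP t) (by positivity)) (hr0 n))
        _ = _ := by ring
    refine (Finset.sum_le_sum h1).trans ?_
    rw [← Finset.sum_mul, div_eq_mul_one_div, mul_comm]
    exact mul_le_mul_of_nonneg_left (sum_beta1_le hP n)
      (mul_nonneg (mul_nonneg (hpos n) (by positivity)) (hr0 n))
  · exact (le_abs_self _).trans (abs_sum_mul_le_of_monotone (mul_nonneg (hpos 0) (hr0 0))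
      (fun a b hab => mul_le_mul (η_mono hab) (hrm hab) (hr0 a) (hpos b)) hdev)

theorem argmax_pos (hη : 0 < η₀) {T τ : ℕ} (hT : 1 ≤ T) (hτ : IsArgmax P c η₀ κ g x₀ T τ) :
    0 < τ := by
  rcases τ.eq_zero_or_pos with rfl | h
  · have h1 := hτ.2 1 hT
    have h2 : 0 < η₀ / η P c η₀ κ g x₀ 1 := div_pos hη (hη.trans_le (le_η 1))
    simp only [ratio, Finset.sum_range_one, Finset.sum_range_zero, η_zero] at h1
    linarith
  · exact h

/-- The convergence argument uses only these two properties of `theta`. -/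
theorem one_le_theta_and_log_le {t : ℕ} (ht : 0 < t) {δ : ℝ} (hδ : 0 < δ) (hδ1 : δ < 1) :
    1 ≤ theta t δ ∧ Real.log (2 / δ) ≤ theta t δ := by
  have ht' : (1 : ℝ) ≤ t := by exact_mod_cast ht
  have he := Real.exp_one_lt_d9
  have h1 : 1 ≤ Real.log (6 * t) := by
    rw [Real.le_log_iff_exp_le (by linarith)]; linarith
  have h2 : 60 / δ ≤ 60 * Real.log (6 * t) / δ := by gcongr; linarith
  have h3 : 60 ≤ 60 / δ := by rw [le_div_iff₀ hδ]; linarith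
  refine ⟨?_, Real.log_le_log (by positivity) (le_trans (by gcongr; norm_num) h2)⟩
  rw [theta, Real.le_log_iff_exp_le (by linarith)]
  linarith

/-- The constant of the convergence bound. -/
def boundConst (P : Params) : ℝ :=
  5 + 2 / ((1 - P.β₁) * (1 - P.β₂)) + 2 / (1 - P.lam) + 1 / (1 - P.β₂)

theorem five_le_boundConst (hP : P.Valid) : 5 ≤ boundConst P := by
  have h1 := sub_pos.2 hP.β₁_lt_one
  have h2 := sub_pos.2 hP.β₂_lt_one
  have h3 := sub_pos.2 hP.lam_lt_one
  have : 0 ≤ 2 / ((1 - P.β₁) * (1 - P.β₂)) + 2 / (1 - P.lam) + 1 / (1 - P.β₂) := by positivity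
  unfold boundConst
  linarith

theorem sum_mul_inner_le_boundConst (hP : P.Valid) (hη : 0 < η₀) (hκ : 0 ≤ κ) {B G δ : ℝ} {n : ℕ}
    {h : ℕ → Vec d} (hn : 0 < n) (hδ : 0 < δ) (hδ1 : δ < 1) (hκB : κ * √(d : ℝ) ≤ B)
    (hs : ‖s P c g n‖ ≤ B) (hg : ∀ t < n, ‖g t‖ ≤ G) (hG : 0 < G) (hGB : G ≤ B)
    (hdev : ∀ t ≤ n, |∑ k ∈ Finset.range t, (inner ℝ (dir P c η₀ κ g x₀ xs k) (h k) -
      inner ℝ (dir P c η₀ κ g x₀ xs k) (g k))| ≤ 2 * B * Real.log (2 / δ) +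
        (∑ k ∈ Finset.range t, inner ℝ (dir P c η₀ κ g x₀ xs k) (g k) ^ 2) / (2 * B)) :
    ∑ t ∈ Finset.range n, η P c η₀ κ g x₀ t * inner ℝ (x P c η₀ κ g x₀ t - xs) (h t) ≤
      η P c η₀ κ g x₀ n * (max (D P c η₀ κ g x₀ xs n) η₀ ^ 2 / η₀) *
        (√(d : ℝ) * B * theta n δ * boundConst P) := by
  have h1 := sub_pos.2 hP.β₁_lt_one
  have h2 := sub_pos.2 hP.β₂_lt_one
  have h3 := sub_pos.2 hP.lam_lt_one
  have hB : 0 < B := hG.trans_le hGB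
  obtain ⟨hθ1, hθ2⟩ := one_le_theta_and_log_le hn hδ hδ1
  -- The empirical second moments are dominated by `‖s_n‖²`, so the bound is of order `B²` and not
  -- `n G²`.
  have hV : ∀ t ≤ n, ∑ k ∈ Finset.range t, inner ℝ (dir P c η₀ κ g x₀ xs k) (g k) ^ 2 ≤
      B ^ 2 / (1 - P.β₂) := fun t ht => by
    calc _ ≤ ∑ k ∈ Finset.range t, ‖g k‖ ^ 2 := by
          refine Finset.sum_le_sum fun k _ => sq_le_sq' ?_ ?_
          all_goals
            have h4 := abs_le.1 ((abs_real_inner_le_norm (dir P c η₀ κ g x₀ xs k) (g k)).trans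
              (mul_le_of_le_one_left (norm_nonneg _) (norm_dir_le_one k)))
            linarith
      _ ≤ ∑ k ∈ Finset.range n, ‖g k‖ ^ 2 :=
          Finset.sum_le_sum_of_subset_of_nonneg (Finset.range_mono ht) fun _ _ _ => sq_nonneg _
      _ ≤ _ := by
          rw [le_div_iff₀ h2, mul_comm]
          exact (mul_sum_norm_sq_le (c := c) hP n).trans (pow_le_pow_left₀ (norm_nonneg _) hs 2)
  have hA : ∀ t ≤ n, |∑ k ∈ Finset.range t, (inner ℝ (dir P c η₀ κ g x₀ xs k) (h k) -
      inner ℝ (dir P c η₀ κ g x₀ xs k) (g k))| ≤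
        B * theta n δ * (2 + 1 / (2 * (1 - P.β₂))) := fun t ht => by
    refine (hdev t ht).trans ?_
    have h4 : (∑ k ∈ Finset.range t, inner ℝ (dir P c η₀ κ g x₀ xs k) (g k) ^ 2) / (2 * B) ≤
        B * (1 / (2 * (1 - P.β₂))) := by
      rw [div_le_iff₀ (by positivity)]
      refine (hV t ht).trans_eq ?_
      field_simp
    have h5 : B * (1 / (2 * (1 - P.β₂))) ≤ B * (1 / (2 * (1 - P.β₂))) * theta n δ :=
      le_mul_of_one_le_right (by positivity) hθ1
    nlinarith [mul_le_mul_of_nonneg_left hθ2 (by positivity : 0 ≤ 2 * B)]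
  refine (sum_mul_inner_le hP hη.le hκ hκB hs hg hG.le hA).trans ?_
  have hD0 := D_nonneg (P := P) (c := c) (η₀ := η₀) (κ := κ) (g := g) (x₀ := x₀) (xs := xs) n
  have hη2 := η_le_two_mul_max (P := P) (c := c) (κ := κ) (g := g) (x₀ := x₀) (xs := xs) hη.le n
  have hηn : η₀ ≤ η P c η₀ κ g x₀ n := le_η n
  set e := η P c η₀ κ g x₀ n
  set Δ := D P c η₀ κ g x₀ xs n
  set M := max Δ η₀
  set r := √(d : ℝ)
  set θ := theta n δ
  set K := 1 / ((1 - P.β₁) * (1 - P.β₂)) with hK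
  set Λ := 1 / (1 - P.lam) with hΛ
  set V := 1 / (1 - P.β₂) with hVdef
  have hK0 : 0 ≤ K := by positivity
  have hΛ0 : 0 ≤ Λ := by positivity
  have hV0 : 0 ≤ V := by positivity
  have hr0 : 0 ≤ r := Real.sqrt_nonneg _
  have hDM : Δ ≤ M := le_max_left _ _
  have hM0 : η₀ ≤ M := le_max_right _ _
  have he : 0 < e := hη.trans_le hηn
  -- all terms are multiples of `Q`
  set Q := e * (M ^ 2 / η₀) with hQ
  have hMpos : 0 < M := hη.trans_le hM0
  have q1 : Δ ^ 2 ≤ Q := by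
    rw [hQ, mul_div_assoc', le_div_iff₀ hη, mul_comm]
    exact mul_le_mul hηn (pow_le_pow_left₀ hD0 hDM 2) (sq_nonneg _) he.le
  have q2 : e * M ≤ Q := by
    refine mul_le_mul_of_nonneg_left ?_ he.le
    rw [le_div_iff₀ hη, sq]
    exact mul_le_mul_of_nonneg_left hM0 hMpos.le
  -- From `e ≤ 2 * M`, the bound of the step size by the distance.
  have q3 : e ^ 2 ≤ 2 * Q := by nlinarith
  have q4 : e * Δ ≤ Q := (mul_le_mul_of_nonneg_left hDM he.le).trans q2
  have hQ0 : 0 ≤ Q := by positivity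
  have hrB : 0 ≤ r * B := by positivity
  -- The three contributions `1 + 2K`, `2Λ` and `4 + V` add up to `boundConst`.
  have t1 : r * B * (Δ ^ 2 + e ^ 2 / ((1 - P.β₁) * (1 - P.β₂))) ≤
      r * B * θ * (Q * (1 + 2 * K)) := by
    have : Δ ^ 2 + e ^ 2 / ((1 - P.β₁) * (1 - P.β₂)) ≤ Q * (1 + 2 * K) := by
      rw [div_eq_mul_one_div]
      nlinarith [mul_le_mul_of_nonneg_right q3 hK0]
    exact mul_le_mul (le_mul_of_one_le_right hrB hθ1) this (by positivity) (by positivity)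
  have t2 : e * (2 * G) * (r * Δ) / (1 - P.lam) ≤ r * B * θ * (Q * (2 * Λ)) := by
    calc e * (2 * G) * (r * Δ) / (1 - P.lam) = r * G * (e * Δ * (2 * Λ)) := by
          rw [hΛ]; ring
      _ ≤ r * B * (Q * (2 * Λ)) := by gcongr
      _ ≤ _ := mul_le_mul_of_nonneg_right (le_mul_of_one_le_right hrB hθ1) (by positivity)
  have t3 : 2 * (e * (r * Δ)) * (B * θ * (2 + 1 / (2 * (1 - P.β₂)))) ≤
      r * B * θ * (Q * (4 + V)) := by
    have e1 : 1 / (2 * (1 - P.β₂)) = V / 2 := by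
      rw [hVdef, div_div, mul_comm]
    rw [e1]
    calc _ = r * B * θ * (e * Δ * (4 + V)) := by ring
      _ ≤ _ := by gcongr
  have hC : boundConst P = 5 + 2 * K + 2 * Λ + V := by
    rw [boundConst, hK, hΛ, hVdef]; ring
  rw [hC]
  linarith

/-- The whole argument for one fixed trajectory; `h` stands for the conditional means, and `hdev` is
the deviation event. -/
theorem xbar_sub_le (hP : P.Valid) {T τ : ℕ} (hT : 1 ≤ T) (hη : 0 < η₀) (hκ : 0 ≤ κ)
    {α G δ : ℝ} (hG : 0 < G) (hα2 : α < 1 / 2) (hδ : 0 < δ) (hδ1 : δ < 1)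
    {f : Vec d → ℝ} (hf : ConvexOn ℝ Set.univ f) {h : ℕ → Vec d}
    (hτ : IsArgmax P c η₀ κ g x₀ T τ) (hκB : κ * √(d : ℝ) ≤ G * (T : ℝ) ^ (1 / 2 - α))
    (hs : ‖s P c g τ‖ ≤ G * (T : ℝ) ^ (1 / 2 - α)) (hg : ∀ t < T, ‖g t‖ ≤ G)
    (hh : ∀ t < T, h t ∈ subdifferential f (x P c η₀ κ g x₀ t))
    (hhG : ∀ t < T, |inner ℝ (dir P c η₀ κ g x₀ xs t) (h t)| ≤ G)
    (hdev : ∀ t ≤ T, |∑ k ∈ Finset.range t, (inner ℝ (dir P c η₀ κ g x₀ xs k) (h k) -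
      inner ℝ (dir P c η₀ κ g x₀ xs k) (g k))| ≤
        2 * (G * (T : ℝ) ^ (1 / 2 - α)) * Real.log (2 / δ) +
        (∑ k ∈ Finset.range t, inner ℝ (dir P c η₀ κ g x₀ xs k) (g k) ^ 2) /
          (2 * (G * (T : ℝ) ^ (1 / 2 - α)))) :
    f (xbar P c η₀ κ g x₀ τ) - f xs ≤
      6 * boundConst P * (1 + Real.log (η P c η₀ κ g x₀ T / η₀)) * theta τ δ *
        (max (D P c η₀ κ g x₀ xs τ) η₀ ^ 2 * G * √(d : ℝ) /
          (η₀ * (T : ℝ) ^ (1 / 2 + α))) := by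
  have hτ0 := argmax_pos hη hT hτ
  have hτT := hτ.1
  have hT1 : (1 : ℝ) ≤ T := by exact_mod_cast hT
  have hT0 : (0 : ℝ) < T := by linarith
  have hpos : ∀ t, 0 < η P c η₀ κ g x₀ t := fun t => hη.trans_le (le_η t)
  have hS : 0 < ∑ t ∈ Finset.range τ, η P c η₀ κ g x₀ t :=
    Finset.sum_pos (fun t _ => hpos t) (Finset.nonempty_range_iff.2 hτ0.ne')
  have hJ := xbar_sub_le_div (xs := xs) hf hη hτ0 fun t ht => hh t (by omega)
  obtain ⟨hθ1, -⟩ := one_le_theta_and_log_le hτ0 hδ hδ1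
  have hC5 := five_le_boundConst hP
  have hL : 0 ≤ Real.log (η P c η₀ κ g x₀ T / η₀) :=
    Real.log_nonneg ((one_le_div hη).2 (le_η T))
  have hM0 : η₀ ≤ max (D P c η₀ κ g x₀ xs τ) η₀ := le_max_right _ _
  have hDM : D P c η₀ κ g x₀ xs τ ≤ max (D P c η₀ κ g x₀ xs τ) η₀ := le_max_left _ _
  have hQ0 : 0 < (T : ℝ) ^ (1 / 2 + α) := Real.rpow_pos_of_pos hT0 _
  set L := Real.log (η P c η₀ κ g x₀ T / η₀)
  set M := max (D P c η₀ κ g x₀ xs τ) η₀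
  set Q := (T : ℝ) ^ (1 / 2 + α) with hQ
  set r := √(d : ℝ)
  set θ := theta τ δ
  have hr0 : 0 ≤ r := Real.sqrt_nonneg _
  have hMpos : 0 < M := hη.trans_le hM0
  -- For such short horizons the right-hand side already exceeds the trivial bound `G * √d * M`, as
  -- `T^(1/2+α) ≤ T`. Otherwise the `+ 1` in `lt_mul_one_add_log` costs at most `T / 2`.
  by_cases hcase : (T : ℝ) < 2 * (1 + L)
  · have h1 : f (xbar P c η₀ κ g x₀ τ) - f xs ≤ G * (r * M) := by
      refine hJ.trans ((div_le_iff₀ hS).2 ?_)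
      rw [Finset.mul_sum]
      refine Finset.sum_le_sum fun t ht => ?_
      have htτ := Finset.mem_range.1 ht
      have h2 : inner ℝ (x P c η₀ κ g x₀ t - xs) (h t) ≤ G * (r * M) := by
        rw [← smul_dir, real_inner_smul_left, mul_comm]
        have h0 : 0 ≤ r * D P c η₀ κ g x₀ xs t := mul_nonneg hr0 (D_nonneg t)
        have h3 : r * D P c η₀ κ g x₀ xs t ≤ r * M :=
          mul_le_mul_of_nonneg_left ((D_mono htτ.le).trans hDM) hr0
        exact mul_le_mul ((le_abs_self _).trans (hhG t (by omega))) h3 h0 hG.le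
      have := mul_le_mul_of_nonneg_left h2 (hpos t).le
      linarith
    have hQT : Q ≤ 2 * (1 + L) := by
      refine le_trans ?_ hcase.le
      calc Q ≤ (T : ℝ) ^ (1 : ℝ) := Real.rpow_le_rpow_of_exponent_le hT1 (by linarith)
        _ = T := Real.rpow_one _
    refine h1.trans ?_
    rw [mul_div_assoc', le_div_iff₀ (by positivity)]
    calc G * (r * M) * (η₀ * Q) = M * η₀ * Q * (G * r) := by ring
      _ ≤ M * M * (2 * (1 + L)) * (G * r) := by gcongr
      _ ≤ M * M * (6 * boundConst P * (1 + L) * θ) * (G * r) := by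
        have h2 : 2 ≤ 6 * boundConst P * θ := by nlinarith
        have h3 : 2 * (1 + L) ≤ 6 * boundConst P * (1 + L) * θ := by
          nlinarith [mul_le_mul_of_nonneg_right h2 (by linarith : 0 ≤ 1 + L)]
        gcongr
      _ = _ := by ring
  · have hBQ : G * (T : ℝ) ^ (1 / 2 - α) * Q = G * T := by
      rw [hQ, mul_assoc, ← Real.rpow_add hT0]
      norm_num
    have hGB : G ≤ G * (T : ℝ) ^ (1 / 2 - α) :=
      le_mul_of_one_le_right hG.le (Real.one_le_rpow hT1 (by linarith))
    have hW := sum_mul_inner_le_boundConst (xs := xs) (h := h) hP hη hκ hτ0 hδ hδ1 hκB hs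
      (fun t ht => hg t (by omega)) hG hGB fun t ht => hdev t (ht.trans hτT)
    set B := G * (T : ℝ) ^ (1 / 2 - α)
    have hB : 0 < B := hG.trans_le hGB
    set R := ratio P c η₀ κ g x₀ τ with hR
    have hRS : ∑ t ∈ Finset.range τ, η P c η₀ κ g x₀ t = R * η P c η₀ κ g x₀ τ := by
      rw [hR, ratio, ← Finset.sum_div, div_mul_cancel₀ _ (hpos τ).ne']
    have hR0 : 0 < R := by
      rw [hRS] at hS
      exact pos_of_mul_pos_left hS (hpos τ).le
    have hlog : (T : ℝ) < (Real.exp 1 * R + 1) * (1 + L) :=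
      lt_mul_one_add_log (y := η P c η₀ κ g x₀) hη η_mono hR0 hτ.2
    -- Absorbing that half leaves `T ≤ 2e (1 + L) R`, and `e < 3`.
    have hTR : T ≤ 6 * (1 + L) * R := by
      have he := Real.exp_one_lt_d9
      have : 0 ≤ (3 - Real.exp 1) * (R * (1 + L)) :=
        mul_nonneg (by linarith) (by positivity)
      nlinarith
    refine hJ.trans ((div_le_iff₀ hS).2 (hW.trans ?_))
    rw [hRS]
    have hkey : B ≤ 6 * (1 + L) * (G / Q) * R := by
      rw [show 6 * (1 + L) * (G / Q) * R = 6 * (1 + L) * R * G / Q by ring, le_div_iff₀ hQ0, hBQ,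
        mul_comm]
      exact mul_le_mul_of_nonneg_right hTR hG.le
    calc η P c η₀ κ g x₀ τ * (M ^ 2 / η₀) * (r * B * θ * boundConst P)
        = B * (η P c η₀ κ g x₀ τ * (M ^ 2 / η₀) * (r * θ * boundConst P)) := by ring
      _ ≤ 6 * (1 + L) * (G / Q) * R *
          (η P c η₀ κ g x₀ τ * (M ^ 2 / η₀) * (r * θ * boundConst P)) := by
        refine mul_le_mul_of_nonneg_right hkey ?_
        have := hpos τ
        positivity
      _ = _ := by field_simp

end Iterates

/-! ### Measurability of the iterates -/

section Measurability

variable {Ω : Type*} [MeasurableSpace Ω] {d : ℕ} {P : Params} {c : Variant} {η₀ κ : ℝ}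
  {g : ℕ → Ω → Vec d} {x₀ xs : Vec d}

theorem measurable_apply {y : Ω → Vec d} (hy : Measurable y) (i : Fin d) :
    Measurable fun ω => y ω i :=
  (measurable_pi_apply i).comp ((WithLp.measurable_ofLp 2 _).comp hy)

theorem measurable_m {t : ℕ} (hg : ∀ k ≤ t, Measurable (g k)) :
    Measurable fun ω => m P (g · ω) t := by
  induction t with
  | zero => exact (hg 0 le_rfl).const_smul (1 - beta1 P 0)
  | succ t ih =>
    exact ((ih fun k hk => hg k (by omega)).const_smul (beta1 P (t + 1))).add
      ((hg (t + 1) le_rfl).const_smul (1 - beta1 P (t + 1)))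

theorem measurable_v {t : ℕ} (hg : ∀ k ≤ t, Measurable (g k)) (i : Fin d) :
    Measurable fun ω => v P (g · ω) i t := by
  induction t with
  | zero => exact ((measurable_apply (hg 0 le_rfl) i).pow_const 2).const_mul _
  | succ t ih =>
    exact ((ih fun k hk => hg k (by omega)).const_mul _).add
      (((measurable_apply (hg (t + 1) le_rfl) i).pow_const 2).const_mul _)

theorem measurable_s {t : ℕ} (hg : ∀ k ≤ t, Measurable (g k)) (i : Fin d) :
    Measurable fun ω => s P c (g · ω) t i := by
  cases c with
  | case1 =>
    exact (Finset.measurable_sum _ fun k hk => (measurable_apply (hg k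
      (Nat.lt_succ_iff.1 (Finset.mem_range.1 hk))) i).pow_const 2).sqrt
  | case2 =>
    exact ((Finset.measurable_range_sup'' fun k hk =>
      measurable_v (P := P) (fun j hj => hg j (hj.trans hk)) i).const_mul (t + 1 : ℝ)).sqrt

theorem measurable_x_and_η {t : ℕ} (hg : ∀ k < t, Measurable (g k)) :
    (Measurable fun ω => x P c η₀ κ (g · ω) x₀ t) ∧
      Measurable fun ω => η P c η₀ κ (g · ω) x₀ t := by
  induction t with
  | zero => exact ⟨measurable_const, measurable_const⟩
  | succ t ih =>
    obtain ⟨hx, hη⟩ := ih fun k hk => hg k (by omega)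
    have hg' : ∀ k ≤ t, Measurable (g k) := fun k hk => hg k (Nat.lt_succ_of_le hk)
    have hx' : Measurable fun ω => x P c η₀ κ (g · ω) x₀ (t + 1) :=
      (WithLp.measurable_toLp 2 _).comp (measurable_pi_lambda _ fun i =>
        (measurable_apply hx i).sub (hη.mul ((measurable_apply (measurable_m hg') i).div
          ((measurable_s hg' i).const_add κ))))
    exact ⟨hx', hη.max ((hx'.sub_const x₀).norm.div_const _)⟩

/-- Only `g k` with `k < t` enter. Taken with `ℱ t` as the σ-algebra on `Ω`, this is predictability
of the direction. -/
theorem measurable_dir {t : ℕ} (hg : ∀ k < t, Measurable (g k)) :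
    Measurable fun ω => dir P c η₀ κ (g · ω) x₀ xs t := by
  have hx : ∀ k ≤ t, Measurable fun ω => x P c η₀ κ (g · ω) x₀ k - xs := fun k hk =>
    (measurable_x_and_η fun j hj => hg j (by omega)).1.sub_const xs
  have hD : Measurable fun ω => D P c η₀ κ (g · ω) x₀ xs t :=
    Finset.measurable_range_sup'' fun k hk => ((WithLp.measurable_ofLp 2 _).comp (hx k hk)).norm
  exact (hD.const_mul _).inv.smul (hx t le_rfl)

end Measurability

end AdamPP

end

theorem corollary3 (P : AdamPP.Params) (hβ₁ : 0 < P.β₁) (hβ₁₂ : P.β₁ < √P.β₂) (hβ₂ : P.β₂ < 1)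
    (hlam₀ : 0 < P.lam) (hlam₁ : P.lam < 1) :
    ∃ C : ℝ, 0 < C ∧
      ∀ (c : AdamPP.Variant) (d T : ℕ) (η₀ κ G α δ : ℝ) (f l : AdamPP.Vec d → ℝ)
        (x₀ xs : AdamPP.Vec d) (Ω : Type*) [mΩ : MeasurableSpace Ω] (μ : Measure Ω)
        [IsProbabilityMeasure μ] (ℱ : Filtration ℕ mΩ) (g : ℕ → Ω → AdamPP.Vec d) (τ : Ω → ℕ),
        1 ≤ T → 0 < η₀ → 0 < G → 0 ≤ α → α < 1 / 2 → 0 < δ → δ < 1 →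
        0 ≤ κ → κ * √(d : ℝ) ≤ G * (T : ℝ) ^ (1 / 2 - α) →
        ConvexOn ℝ Set.univ f → Continuous l → (∀ y, l y ≤ G) →
        AdamPP.IsOracleRun μ ℱ f l T (fun t ω => AdamPP.x P c η₀ κ (g · ω) x₀ t) g →
        (∀ ω, AdamPP.IsArgmax P c η₀ κ (g · ω) x₀ T (τ ω)) →
        (∀ᵐ ω ∂μ, ‖AdamPP.s P c (g · ω) (τ ω)‖ ≤ G * (T : ℝ) ^ (1 / 2 - α)) →
        μ {ω | ¬ (f (AdamPP.xbar P c η₀ κ (g · ω) x₀ (τ ω)) - f xs ≤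
            C * (1 + Real.log (AdamPP.η P c η₀ κ (g · ω) x₀ T / η₀)) * AdamPP.theta (τ ω) δ *
              (max (AdamPP.D P c η₀ κ (g · ω) x₀ xs (τ ω)) η₀ ^ 2 * G * √(d : ℝ) /
                (η₀ * (T : ℝ) ^ (1 / 2 + α))))} ≤ ENNReal.ofReal δ := by
  have hsqrt : 0 < √P.β₂ := hβ₁.trans hβ₁₂
  have hP : P.Valid :=
    { β₁_nonneg := hβ₁.le
      β₁_lt_one := hβ₁₂.trans ((Real.sqrt_lt' one_pos).2 (by simpa using hβ₂))
      β₂_nonneg := (Real.sqrt_pos.1 hsqrt).le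
      β₂_lt_one := hβ₂
      lam_nonneg := hlam₀.le
      lam_lt_one := hlam₁ }
  refine ⟨6 * AdamPP.boundConst P, by linarith [AdamPP.five_le_boundConst hP], ?_⟩
  intro c d T η₀ κ G α δ f l x₀ xs Ω mΩ μ _ ℱ g τ hT hη hG _ hα2 hδ hδ1 hκ hκB hf _ hl hrun hτ hs
  have hT1 : (1 : ℝ) ≤ T := by exact_mod_cast hT
  have hGB : G ≤ G * (T : ℝ) ^ (1 / 2 - α) :=
    le_mul_of_one_le_right hG.le (Real.one_le_rpow hT1 (by linarith))
  set B := G * (T : ℝ) ^ (1 / 2 - α) with hB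
  set u : ℕ → Ω → AdamPP.Vec d := fun t ω => AdamPP.dir P c η₀ κ (g · ω) x₀ xs t with hu
  have hum : ∀ t < T, StronglyMeasurable[ℱ t] (u t) := fun t ht =>
    (@AdamPP.measurable_dir Ω (ℱ t) d P c η₀ κ g x₀ xs t fun k hk =>
      (hrun.adapted k (by omega)).measurable.mono (ℱ.mono hk) le_rfl).stronglyMeasurable
  have hu1 : ∀ t ω, ‖u t ω‖ ≤ 1 := fun t ω => AdamPP.norm_dir_le_one t
  have hgb : ∀ t < T, ∀ᵐ ω ∂μ, ‖g t ω‖ ≤ G := fun t ht => by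
    filter_upwards [hrun.bounded t ht.le] with ω hω using hω.trans (hl _)
  have hgi : ∀ t < T, Integrable (g t) μ := fun t ht => Integrable.of_bound
    ((hrun.adapted t ht.le).mono (ℱ.le _)).aestronglyMeasurable _ (hgb t ht)
  set Y : ℕ → Ω → ℝ := fun t ω => inner ℝ (u t ω) (g t ω) with hYdef
  have hYm : ∀ t < T, StronglyMeasurable[ℱ (t + 1)] (Y t) := fun t ht =>
    ((hum t ht).mono (ℱ.mono t.le_succ)).inner (hrun.adapted t ht.le)
  have hYb : ∀ t < T, ∀ᵐ ω ∂μ, |Y t ω| ≤ G := fun t ht => by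
    filter_upwards [hgb t ht] with ω hω
    exact (abs_real_inner_le_norm _ _).trans
      ((mul_le_of_le_one_left (norm_nonneg _) (hu1 t ω)).trans hω)
  -- The predictable direction is pulled out of the conditional expectation.
  have hYE : ∀ t < T, ∀ᵐ ω ∂μ, (μ[Y t | ℱ t]) ω = inner ℝ (u t ω) ((μ[g t | ℱ t]) ω) :=
    fun t ht => condExp_stronglyMeasurable_bilin_of_bound (innerSL ℝ) (ℱ.le t) (hum t ht)
      (hgi t ht) 1 (Filter.Eventually.of_forall (hu1 t))
  have hEb : ∀ t < T, ∀ᵐ ω ∂μ, |(μ[Y t | ℱ t]) ω| ≤ G := fun t ht =>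
    ae_bdd_abs_condExp_of_ae_bdd_abs (hYb t ht)
  have hae : ∀ᵐ ω ∂μ, ∀ t < T, ‖g t ω‖ ≤ G ∧
      (μ[Y t | ℱ t]) ω = inner ℝ (u t ω) ((μ[g t | ℱ t]) ω) ∧ |(μ[Y t | ℱ t]) ω| ≤ G ∧
      (μ[g t | ℱ t]) ω ∈ AdamPP.subdifferential f (AdamPP.x P c η₀ κ (g · ω) x₀ t) := by
    refine ae_all_iff.2 fun t => ?_
    by_cases ht : t < T
    · filter_upwards [hgb t ht, hYE t ht, hEb t ht, hrun.unbiased t ht.le] with ω h1 h2 h3 h4 _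
        using ⟨h1, h2, h3, h4⟩
    · exact Filter.Eventually.of_forall fun ω h => absurd h ht
  -- The level `b = B`, larger than the almost sure bound `G`, balances `2 b log(2/δ)` against `V /
  -- (2b)` when `V` is of order `B²`.
  refine (measure_mono_ae ?_).trans (AdamPP.measure_not_forall_abs_sum_le (b := B)
    (hG.trans_le hGB) hδ hYm fun t ht => (hYb t ht).mono fun ω hω => hω.trans hGB)
  filter_upwards [hae, hs] with ω h1 h2
  refine fun hbad hdev => hbad (AdamPP.xbar_sub_le hP hT hη hκ hG hα2 hδ hδ1 hf
    (h := fun t => (μ[g t | ℱ t]) ω) (hτ ω) hκB h2 (fun t ht => (h1 t ht).1)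
    (fun t ht => (h1 t ht).2.2.2) (fun t ht => (h1 t ht).2.1 ▸ (h1 t ht).2.2.1) fun t ht => ?_)
  rw [← hB]
  refine le_trans (le_of_eq ?_) (hdev t ht)
  congr 1
  exact Finset.sum_congr rfl fun k hk => by
    rw [(h1 k ((Finset.mem_range.1 hk).trans_le ht)).2.1]
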